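/- Let $a>0$, let $S^a: w\mapsto w+a$, and let $E,F,G\in \mathrm{SL}(2,\mathbb R)$ act on the upper half-plane $\mathcal H=\{X+iY: Y>0\}$ as elliptic elements of order two with $S^aE=GF$ as transformations of $\mathcal H$ (equivalently $GFE=\pm S^a$ as matrices). Write $1/z,1/y,1/x$ for the heights (imaginary parts) of the fixed points of $E,F,G$ respectively, and assume $z\ge\max\{x,y\}$. Put $r_a(t)=\sqrt{a^2/4-1/t^2}$. For $A=\begin{pmatrix}\alpha&\beta\\ \gamma&-\alpha\end{pmatrix}\in \mathrm{SL}(2,\mathbb R)$ let $\mathcal U(A)=\{(X,Y)\in\mathcal H: |(X-\alpha/\gamma)^2-Y^2|<1/\gamma^2\}$, let $\mathcal U_-(A)$ be its part with $X<\alpha/\gamma$ and $\mathcal U_+(A)$ its part with $X\ge\alpha/\gamma$; the upper (resp. lower) boundary of $\mathcal U(A)$ is $\{(X-\alpha/\gamma)^2-Y^2=-1/\gamma^2\}$ (resp. $\{(X-\alpha/\gamma)^2-Y^2=1/\gamma^2\}$), and the lower boundary of $\mathcal U_-(A)$ (resp. $\mathcal U_+(A)$) is the part of the lower boundary with $X<\alpha/\gamma$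 (resp. $X\ge\alpha/\gamma$). For order two elements $A,B$ with distinct fixed points let $\mathrm{ap}(AB)$ be the apex (highest point) of the non-vertical geodesic through their fixed points; $\mathcal U(A)$ and $\mathcal U(B)$ bifurcate at a point where their upper boundaries meet. The bicorn region of a triple $(E,F,G)$ is $\mathcal U_-(G)\cup\mathcal U_+(F)$. Put $\lambda(E,F,G)=(EFE,E,G)$ and $\rho(E,F,G)=(FGF,F,S^aES^{-a})$; the $\lambda,\rho$-tree of $(E,F,G)$ consists of all triples obtained from it by finite compositions (including the identity) of $\lambda$ and $\rho$, and $\mathcal U_{\lambda,\rho}(E,F,G)$ is the union of the bicorn regions of all these triples. Then: 1. For every triple $(E',F',G')$ of the tree, with $1/z'$ the height of the fixed point of $E'$, the intersection of $r_a(z')\le Y<a/2$ with the union of the bicorn regions of $(E',F',G')$, $\lambda(E',F',G')$ and $\rho(E',F',G')$ is a once-punctured trident: a region between a left and a right edge which are graphs over $Y$, whose upper part is split into three disjoint prongs by two closed notches, each starting at a single point (a bifurcation of the trident) and opening upwards up to $Y=a/2$, and from which one point (the puncture), lying lower than both bifurcations and strictly between the edges, is removed. The puncture is $\mathrm{ap}(G'F')$;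 the bifurcations are $\mathrm{ap}(G'E')$ and $\mathrm{ap}(F'S^aE'S^{-a})$, and $\mathcal U(G'),\mathcal U(E')$, respectively $\mathcal U(F'),\mathcal U(S^aE'S^{-a})$, bifurcate there. 2. Let $D$ be the part of the strip $r_a(z)<Y<a/2$ strictly between the lower boundary of $\mathcal U_-(G)$ on the left and the lower boundary of $\mathcal U_+(F)$ on the right. Then $D$ is open and connected, its topological boundary inside the open strip is exactly the part in the strip of these two lower boundaries, and the intersection of $\mathcal U_{\lambda,\rho}(E,F,G)$ with the strip is $D\setminus P$, where $P$ is the set of the points $\mathrm{ap}(G'F')$ for the triples $(E',F',G')$ of the tree obtained by a nonempty composition of $\lambda$ and $\rho$; moreover $P\subset D$ is infinite and has no accumulation point in $D$. -/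

import Mathlib

open Set Filter Topology

noncomputable section

namespace Uplift

/-- The group `SL(2, ℝ)`; it acts on the upper half-plane, and `A` and `-A` act in the same way. -/
abbrev SL2R : Type := Matrix.SpecialLinearGroup (Fin 2) ℝ

/-- The translation `S^a : w ↦ w + a`. -/
def translation (a : ℝ) : SL2R :=
  ⟨!![1, a; 0, 1], by simp [Matrix.det_fin_two_of]⟩

/-- `A` acts on the upper half-plane as an elliptic element of order two. An element of
`SL(2, ℝ)` has order two in `PSL(2, ℝ)` exactly when its square is `-1`. -/
def IsEllipticOrderTwo (A : SL2R) : Prop := A * A = -1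

/-- For `A` with rows `(α, β)` and `(γ, -α)`: the real number `α / γ`. -/
def center (A : SL2R) : ℝ := A 0 0 / A 1 0

/-- The fixed point `(α + i) / γ` (taken in the upper half-plane) of an elliptic element of
order two, in coordinates `(X, Y)`. -/
def fixedPoint (A : SL2R) : ℝ × ℝ := (center A, 1 / |A 1 0|)

/-- The multiplicative inverse of the height of the fixed point. -/
def invHeight (A : SL2R) : ℝ := 1 / (fixedPoint A).2

/-- `fixedPoint` is the fixed point. -/
theorem smul_eq_self_iff (A : SL2R) (hA : IsEllipticOrderTwo A) (w : UpperHalfPlane) :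
    A • w = w ↔ fixedPoint A = (w.re, w.im) := by
  have hdet := A.det_coe
  rw [Matrix.det_fin_two] at hdet
  have hsq : (A : Matrix (Fin 2) (Fin 2) ℝ) * A = -1 := by
    have := congrArg (fun B : SL2R => (B : Matrix (Fin 2) (Fin 2) ℝ)) hA
    simpa using this
  have h00 := congrFun (congrFun hsq 0) 0
  have h10 := congrFun (congrFun hsq 1) 0
  simp [Matrix.mul_apply, Fin.sum_univ_two] at h00 h10
  have hc : A 1 0 ≠ 0 := by
    intro h; rw [h] at h00; nlinarith [mul_self_nonneg (A 0 0)]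
  have htr : A 1 1 = -A 0 0 := by
    have : A 1 0 * (A 0 0 + A 1 1) = 0 := by linear_combination h10
    rcases mul_eq_zero.mp this with h | h
    · exact absurd h hc
    · linarith
  have him := w.im_pos
  have hden : ((A 1 0 : ℝ) : ℂ) * w + ((A 1 1 : ℝ) : ℂ) ≠ 0 := by
    intro h
    have := congrArg Complex.im h
    simp at this
    rcases this with h | h
    · exact hc h
    · exact him.ne' h
  have hval : A • w = w ↔ A 1 0 * (w.re ^ 2 - w.im ^ 2) - 2 * A 0 0 * w.re - A 0 1 = 0 ∧
      A 1 0 * w.re = A 0 0 := by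
    rw [UpperHalfPlane.ext_iff, UpperHalfPlane.specialLinearGroup_apply]
    simp only [Algebra.algebraMap_self, RingHom.id_apply]
    rw [div_eq_iff hden, htr, Complex.ext_iff]
    simp
    constructor
    · rintro ⟨h1, h2⟩
      constructor
      · linarith
      · have : w.im * (A 1 0 * w.re - A 0 0) = 0 := by linarith
        rcases mul_eq_zero.mp this with h | h
        · exact absurd h him.ne'
        · linarith
    · rintro ⟨h1, h2⟩
      constructor
      · linarith
      · have : w.im * (A 1 0 * w.re - A 0 0) = 0 := by rw [h2]; ring
        linarith
  rw [hval, fixedPoint, center, Prod.mk.injEq, div_eq_iff hc]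
  rw [htr] at hdet
  constructor
  · rintro ⟨h1, h2⟩
    refine ⟨by linarith, ?_⟩
    have h3 : (|A 1 0| * w.im) ^ 2 = 1 := by
      rw [mul_pow, sq_abs]; rw [← h2] at h1 hdet; linear_combination (-A 1 0) * h1 + hdet
    have h4 : |A 1 0| * w.im = 1 := by
      have : 0 < |A 1 0| * w.im := mul_pos (abs_pos.mpr hc) him
      nlinarith
    rw [div_eq_iff (abs_pos.mpr hc).ne']; linarith
  · rintro ⟨h1, h2⟩
    rw [div_eq_iff (abs_pos.mpr hc).ne'] at h2
    have h3 : A 1 0 ^ 2 * w.im ^ 2 = 1 := by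
      rw [← sq_abs (A 1 0), ← mul_pow, mul_comm, ← h2]; norm_num
    refine ⟨?_, by linarith⟩
    have : A 1 0 * (A 1 0 * (w.re ^ 2 - w.im ^ 2) - 2 * A 0 0 * w.re - A 0 1) = 0 := by
      rw [h1] at hdet ⊢; linear_combination hdet - h3
    exact (mul_eq_zero.mp this).resolve_left hc

/-- `p` is the apex of the geodesic of the upper half-plane which passes through the fixed points
of `A` and `B`: this geodesic is the half-circle of centre `p.1` and radius `p.2`. (The two fixed
points are required to be distinct, so that there is at most one such `p`.) -/
def IsApex (A B : SL2R) (p : ℝ × ℝ) : Prop :=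
  0 < p.2 ∧ fixedPoint A ≠ fixedPoint B ∧
    ((fixedPoint A).1 - p.1) ^ 2 + (fixedPoint A).2 ^ 2 = p.2 ^ 2 ∧
    ((fixedPoint B).1 - p.1) ^ 2 + (fixedPoint B).2 ^ 2 = p.2 ^ 2

/-- The uplift region `U(A)`. -/
def upliftRegion (A : SL2R) : Set (ℝ × ℝ) :=
  {w | 0 < w.2 ∧ |(w.1 - center A) ^ 2 - w.2 ^ 2| < 1 / (A 1 0) ^ 2}

/-- The left part `U₋(A)` of the uplift region. -/
def upliftMinus (A : SL2R) : Set (ℝ × ℝ) := {w | w ∈ upliftRegion A ∧ w.1 < center A}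

/-- The remaining part `U₊(A)` of the uplift region. -/
def upliftPlus (A : SL2R) : Set (ℝ × ℝ) := {w | w ∈ upliftRegion A ∧ center A ≤ w.1}

/-- The upper boundary of `U(A)`. -/
def upperBoundary (A : SL2R) : Set (ℝ × ℝ) :=
  {w | 0 < w.2 ∧ (w.1 - center A) ^ 2 - w.2 ^ 2 = -(1 / (A 1 0) ^ 2)}

/-- The lower boundary of `U(A)`. -/
def lowerBoundary (A : SL2R) : Set (ℝ × ℝ) :=
  {w | 0 < w.2 ∧ (w.1 - center A) ^ 2 - w.2 ^ 2 = 1 / (A 1 0) ^ 2}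

/-- The lower boundary of `U₋(A)`. -/
def lowerBoundaryMinus (A : SL2R) : Set (ℝ × ℝ) := {w | w ∈ lowerBoundary A ∧ w.1 < center A}

/-- The lower boundary of `U₊(A)`. -/
def lowerBoundaryPlus (A : SL2R) : Set (ℝ × ℝ) := {w | w ∈ lowerBoundary A ∧ center A ≤ w.1}

/-- The uplift regions of `A` and `B` bifurcate at `p`. -/
def Bifurcate (A B : SL2R) (p : ℝ × ℝ) : Prop := p ∈ upperBoundary A ∧ p ∈ upperBoundary B

/-- The height `r_a(z)`. -/
def lowerHeight (a z : ℝ) : ℝ := Real.sqrt (a ^ 2 / 4 - 1 / z ^ 2)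

/-- An ordered triple `(E, F, G)`. -/
structure Triple where
  E : SL2R
  F : SL2R
  G : SL2R

/-- `E`, `F`, `G` are elliptic of order two and `S^a E = G F`, equivalently `G F E = S^a`, as
transformations of the upper half-plane (that is, up to sign). -/
structure Triple.IsFactorization (a : ℝ) (T : Triple) : Prop where
  orderTwo_E : IsEllipticOrderTwo T.E
  orderTwo_F : IsEllipticOrderTwo T.F
  orderTwo_G : IsEllipticOrderTwo T.G
  factorization : T.G * T.F * T.E = translation a ∨ T.G * T.F * T.E = -translation a

/-- The conjugate `S^a A S^{-a}`. -/
def shift (a : ℝ) (A : SL2R) : SL2R := translation a * A * (translation a)⁻¹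

/-- The move `ρ : (E, F, G) ↦ (FGF, F, S^a E S^{-a})`. -/
def Triple.rho (a : ℝ) (T : Triple) : Triple := ⟨T.F * T.G * T.F, T.F, shift a T.E⟩

/-- The move `λ : (E, F, G) ↦ (EFE, E, G)`. -/
def Triple.lam (T : Triple) : Triple := ⟨T.E * T.F * T.E, T.E, T.G⟩

/-- `InTree a T N`: the triple `N` is obtained from `T` by a finite composition (possibly the
identity) of the moves `λ` and `ρ`. -/
inductive InTree (a : ℝ) (T : Triple) : Triple → Prop
  | root : InTree a T T
  | lam (N : Triple) : InTree a T N → InTree a T N.lam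
  | rho (N : Triple) : InTree a T N → InTree a T (N.rho a)

/-- The bicorn region `U₋(G) ∪ U₊(F)` of `(E, F, G)`. -/
def bicorn (T : Triple) : Set (ℝ × ℝ) := upliftMinus T.G ∪ upliftPlus T.F

/-- The union of the bicorn regions of all triples in the `λ,ρ`-tree of `T`. -/
def treeRegion (a : ℝ) (T : Triple) : Set (ℝ × ℝ) :=
  {w | ∃ N, InTree a T N ∧ w ∈ bicorn N}

/-- The part of the union of the bicorn regions of `N`, `λ(N)`, `ρ(N)` in the half-open strip
`r_a(z) ≤ Y < a/2`, where `1/z` is the height of the fixed point of the first entry of `N`. -/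
def stepRegion (a : ℝ) (N : Triple) : Set (ℝ × ℝ) :=
  {w | lowerHeight a (invHeight N.E) ≤ w.2 ∧ w.2 < a / 2} ∩
    (bicorn N ∪ bicorn N.lam ∪ bicorn (N.rho a))

/-- `W`, a subset of the strip `h ≤ Y < H`, is a once-punctured trident with puncture `p` and
bifurcations at `q₁` (left) and `q₂` (right). It lies between a left edge `X = L(Y)` and a right
edge `X = R(Y)`; two closed notches `l₁(Y) ≤ X ≤ r₁(Y)` and `l₂(Y) ≤ X ≤ r₂(Y)`, which start
with a single point at `q₁` and at `q₂` and open upwards up to the top of the strip, split it into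
three disjoint prongs; and the one point `p` of the handle, below both bifurcations, is missing. -/
def IsOncePuncturedTrident (W : Set (ℝ × ℝ)) (h H : ℝ) (p q₁ q₂ : ℝ × ℝ) : Prop :=
  ∃ L l₁ r₁ l₂ r₂ R : ℝ → ℝ,
    ContinuousOn L (Ico h H) ∧ ContinuousOn R (Ico h H) ∧
    ContinuousOn l₁ (Ico q₁.2 H) ∧ ContinuousOn r₁ (Ico q₁.2 H) ∧
    ContinuousOn l₂ (Ico q₂.2 H) ∧ ContinuousOn r₂ (Ico q₂.2 H) ∧
    h < q₁.2 ∧ q₁.2 < H ∧ h < q₂.2 ∧ q₂.2 < H ∧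
    (∀ Y ∈ Ico h H, L Y < R Y) ∧
    (l₁ q₁.2 = q₁.1 ∧ r₁ q₁.2 = q₁.1 ∧ ∀ Y ∈ Ioo q₁.2 H, l₁ Y < r₁ Y) ∧
    (l₂ q₂.2 = q₂.1 ∧ r₂ q₂.2 = q₂.1 ∧ ∀ Y ∈ Ioo q₂.2 H, l₂ Y < r₂ Y) ∧
    (∀ Y ∈ Ico q₁.2 H, L Y < l₁ Y ∧ r₁ Y < R Y) ∧
    (∀ Y ∈ Ico q₂.2 H, L Y < l₂ Y ∧ r₂ Y < R Y) ∧
    (∀ Y ∈ Ico q₁.2 H ∩ Ico q₂.2 H, r₁ Y < l₂ Y) ∧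
    (h ≤ p.2 ∧ p.2 < q₁.2 ∧ p.2 < q₂.2 ∧ L p.2 < p.1 ∧ p.1 < R p.2) ∧
    W = {w | h ≤ w.2 ∧ w.2 < H ∧ L w.2 < w.1 ∧ w.1 < R w.2 ∧
          ¬ (q₁.2 ≤ w.2 ∧ l₁ w.2 ≤ w.1 ∧ w.1 ≤ r₁ w.2) ∧
          ¬ (q₂.2 ≤ w.2 ∧ l₂ w.2 ≤ w.1 ∧ w.1 ≤ r₂ w.2)} \ {p}

/-- The open horizontal strip `h < Y < H`. -/
def openStrip (h H : ℝ) : Set (ℝ × ℝ) := {w | h < w.2 ∧ w.2 < H}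

/-- The part of the strip `h < Y < H` strictly between the lower boundary of `U₋(G)`, on the left,
and the lower boundary of `U₊(F)`, on the right. -/
def betweenLowerBoundaries (G F : SL2R) (h H : ℝ) : Set (ℝ × ℝ) :=
  {w | w ∈ openStrip h H ∧
    ∃ u ∈ lowerBoundaryMinus G, ∃ v ∈ lowerBoundaryPlus F,
      u.2 = w.2 ∧ v.2 = w.2 ∧ u.1 < w.1 ∧ w.1 < v.1}

/-- `W` is the domain (nonempty connected open set) `D`, punctured at the points of the infinite
set `P`, which has no accumulation point in `D`. -/
def IsInfinitelyPuncturedDomain (W D P : Set (ℝ × ℝ)) : Prop :=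
  IsOpen D ∧ IsConnected D ∧ P ⊆ D ∧ P.Infinite ∧
    (∀ w ∈ D, ∃ V ∈ 𝓝 w, (V ∩ P).Finite) ∧ W = D \ P

/-- The apexes of the geodesics through the fixed points of `G'` and `F'`, for all triples
`(E', F', G')` in the `λ,ρ`-tree of `T` other than the root. -/
def treePunctures (a : ℝ) (T : Triple) : Set (ℝ × ℝ) :=
  {p | ∃ N, (InTree a T.lam N ∨ InTree a (T.rho a) N) ∧ IsApex N.G N.F p}

end Uplift

end

noncomputable section

namespace Uplift

/-! ### Real inequalities for solutions of the Markov-type equation -/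

section Markov

variable {a x y z t : ℝ}

/-! Write x, y, z for the inverse heights of the fixed points of G, F, E. Comparing matrix entries
in GFE = ±S^a gives the Markov-type equation x² + y² + z² = axyz and the horizontal distances
between the fixed points (`markov_and_centers`). The rest compares horizontal slices: at height Y
the regions are intervals with endpoints of the form center ± √(Y² ± 1/t²).

Each triple is governed by the height with Y² = a²/4 - 1/z² and the abscissa center E + a/2. There
the inner curves of U₋(G) and U₊(F) cross, at ap(GF), and so do the outer curves of U₊(E) and U₋(S^a
E S^{-a}), the pieces added by λ and ρ. Below this height U₋(G) and U₊(F) overlap. Above it they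
leave a gap, but the two new pieces now overlap and bridge its middle. At the height itself all four
open intervals end at one point, the puncture. The rest of the gap consists of two notches, which
start at the apexes of λ(N) and ρ(N): this is the trident.

For the whole tree, fix Y. Above the puncture of N the slices of the two child trees overlap and
together fill the slice of N, while the punctures of each child tree lie beyond the reach of the
other pieces (`slice_of_children`). The recursion stops at a triple whose puncture is at or above Y:
the bicorns of all its descendants then lie in its own (`IsShadowed.mem_treeRegion_iff`). This needs
x² + y² ≤ z², which holds at every child of a reduced triple. It does stop, because z grows by a
fixed factor κ > 1 with every move (`HasGrowth`) and punctures are thereby pushed up to a/2. The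
same growth makes the punctures locally finite. -/

theorem sq_half_sub_div (hx : 0 < x) (hz : 0 < z)
    (h : x ^ 2 + y ^ 2 + z ^ 2 = a * x * y * z) :
    (a / 2 - y / (x * z)) ^ 2 = a ^ 2 / 4 - 1 / z ^ 2 - 1 / x ^ 2 := by
  field_simp
  linear_combination 16 * h

/-- From y ≤ z, 2y² ≤ y² + z² < x² + y² + z² = y(axz). Geometrically, the apex ap(GF) lies strictly
to the left of the centre of G; exchanging x and y, strictly to the right of the centre of F. -/
theorem half_sub_div_pos (hx : 0 < x) (hy : 0 < y) (hz : 0 < z)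
    (h : x ^ 2 + y ^ 2 + z ^ 2 = a * x * y * z) (hyz : y ≤ z) : 0 < a / 2 - y / (x * z) := by
  have h1 : y / (x * z) < a / 2 := by
    rw [div_lt_div_iff₀ (by positivity) two_pos]
    have : y * (y * 2) < y * (a * (x * z)) := by nlinarith
    exact lt_of_mul_lt_mul_left this hy.le
  linarith

theorem half_sub_div_le_sqrt (hx : 0 < x) (hz : 0 < z)
    (h : x ^ 2 + y ^ 2 + z ^ 2 = a * x * y * z) (ht : a ^ 2 / 4 - 1 / z ^ 2 ≤ t) :
    a / 2 - y / (x * z) ≤ √(t - 1 / x ^ 2) := by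
  apply Real.le_sqrt_of_sq_le
  rw [sq_half_sub_div hx hz h]
  linarith

/-- Unlike the reverse bound, this one needs the right side to be nonnegative, and y ≤ z enters only
for that. -/
theorem sqrt_le_half_sub_div (hx : 0 < x) (hy : 0 < y) (hz : 0 < z)
    (h : x ^ 2 + y ^ 2 + z ^ 2 = a * x * y * z) (hyz : y ≤ z) (ht : t ≤ a ^ 2 / 4 - 1 / z ^ 2) :
    √(t - 1 / x ^ 2) ≤ a / 2 - y / (x * z) := by
  rw [Real.sqrt_le_left (half_sub_div_pos hx hy hz h hyz).le, sq_half_sub_div hx hz h]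
  linarith

theorem sqrt_lt_half_sub_div (hx : 0 < x) (hy : 0 < y) (hz : 0 < z)
    (h : x ^ 2 + y ^ 2 + z ^ 2 = a * x * y * z) (hyz : y ≤ z) (ht : t < a ^ 2 / 4 - 1 / z ^ 2) :
    √(t - 1 / x ^ 2) < a / 2 - y / (x * z) := by
  rw [Real.sqrt_lt' (half_sub_div_pos hx hy hz h hyz), sq_half_sub_div hx hz h]
  linarith

theorem half_sub_div_lt_sqrt (hx : 0 < x) (hz : 0 < z)
    (h : x ^ 2 + y ^ 2 + z ^ 2 = a * x * y * z) (ht : a ^ 2 / 4 - 1 / z ^ 2 < t) :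
    a / 2 - y / (x * z) < √(t - 1 / x ^ 2) := by
  apply Real.lt_sqrt_of_sq_lt
  rw [sq_half_sub_div hx hz h]
  linarith

/-- Let D = a - y/(xz), the distance between the centres of E and G. The Markov equation says D(a -
D) = 1/x² + 1/z². Expanding (D - s)² with s² = t - 1/z² and s ≥ D - a/2 bounds it by t + 1/x². -/
theorem sub_div_le_sqrt_add_sqrt (hx : 0 < x) (hy : 0 < y) (hz : 0 < z)
    (h : x ^ 2 + y ^ 2 + z ^ 2 = a * x * y * z)
    (ht : a ^ 2 / 4 - 1 / x ^ 2 ≤ t) (htz : 1 / z ^ 2 ≤ t) :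
    a - y / (x * z) ≤ √(t - 1 / z ^ 2) + √(t + 1 / x ^ 2) := by
  set s := √(t - 1 / z ^ 2) with hs
  have hss : s ^ 2 = t - 1 / z ^ 2 := Real.sq_sqrt (by linarith)
  have hsg : a / 2 - y / (x * z) ≤ s := by
    apply Real.le_sqrt_of_sq_le
    rw [sq_half_sub_div hx hz h]
    linarith
  have hD : 0 < a - y / (x * z) := by
    rw [sub_pos, div_lt_iff₀ (by positivity)]
    have : y * y < y * (a * (x * z)) := by nlinarith
    exact lt_of_mul_lt_mul_left this hy.le
  have hid : (a - y / (x * z)) * (y / (x * z)) = 1 / x ^ 2 + 1 / z ^ 2 := by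
    field_simp
    linear_combination -h
  suffices a - y / (x * z) - s ≤ √(t + 1 / x ^ 2) by linarith
  apply Real.le_sqrt_of_sq_le
  nlinarith [mul_le_mul_of_nonneg_left hsg hD.le]

/-- The upper boundaries of U(F) and U(E) meet at squared height a²/4 - 1/x², at signed distance k
to the right of the centre of F. The condition x² + y² ≤ z² is k ≥ 0: the crossing is on the right
branches, and below it the branch of F stays to the left. -/
theorem sqrt_add_div_le_sqrt (hx : 0 < x) (hy : 0 < y) (hz : 0 < z)
    (h : x ^ 2 + y ^ 2 + z ^ 2 = a * x * y * z) (hxyz : x ^ 2 + y ^ 2 ≤ z ^ 2)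
    (ht : t ≤ a ^ 2 / 4 - 1 / x ^ 2) (hty : 1 / y ^ 2 ≤ t) :
    √(t - 1 / y ^ 2) + x / (y * z) ≤ √(t - 1 / z ^ 2) := by
  set v := √(t - 1 / y ^ 2) with hv
  have hvv : v ^ 2 = t - 1 / y ^ 2 := Real.sq_sqrt (by linarith)
  set k := (z ^ 2 - x ^ 2 - y ^ 2) / (2 * x * y * z) with hk
  have hk0 : 0 ≤ k := div_nonneg (by linarith) (by positivity)
  have hkk : k ^ 2 = a ^ 2 / 4 - 1 / x ^ 2 - 1 / y ^ 2 := by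
    have ha : a = (x ^ 2 + y ^ 2 + z ^ 2) / (x * y * z) := by
      rw [eq_div_iff (by positivity)]; linear_combination -h
    rw [hk, ha]
    field_simp
    ring
  have hvk : v ≤ k := by
    rw [hv, Real.sqrt_le_left hk0, hkk]
    linarith
  have hid : 2 * (x / (y * z)) * k + (x / (y * z)) ^ 2 = 1 / y ^ 2 - 1 / z ^ 2 := by
    rw [hk]
    field_simp
    ring
  have hd : 0 ≤ x / (y * z) := by positivity
  apply Real.le_sqrt_of_sq_le
  nlinarith [mul_le_mul_of_nonneg_left hvk hd]

theorem sqrt_sub_add_sqrt_add_le (ha : 0 ≤ a) {b : ℝ} (hb : 0 ≤ b) (hbt : b ≤ t)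
    (ht : t ≤ a ^ 2 / 4) : √(t - b) + √(t + b) ≤ a := by
  apply le_of_sq_le_sq _ ha
  have h1 := Real.sq_sqrt (show 0 ≤ t - b by linarith)
  have h2 := Real.sq_sqrt (show 0 ≤ t + b by linarith)
  -- For the two roots p and q, (p + q)² ≤ 2(p² + q²) = 4t ≤ a².
  nlinarith [sq_nonneg (√(t - b) - √(t + b))]

end Markov

/-! ### Elements of order two -/

namespace IsEllipticOrderTwo

variable {A B : SL2R}

theorem entries (hA : IsEllipticOrderTwo A) :
    A 1 0 ≠ 0 ∧ A 1 1 = -A 0 0 ∧ A 0 0 ^ 2 + A 0 1 * A 1 0 = -1 := by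
  have hsq : (A : Matrix (Fin 2) (Fin 2) ℝ) * A = -1 := by
    have := congrArg (fun B : SL2R => (B : Matrix (Fin 2) (Fin 2) ℝ)) hA
    simpa using this
  have h00 := congrFun (congrFun hsq 0) 0
  have h10 := congrFun (congrFun hsq 1) 0
  simp [Matrix.mul_apply, Fin.sum_univ_two] at h00 h10
  have hc : A 1 0 ≠ 0 := by
    intro h; rw [h] at h00; nlinarith [mul_self_nonneg (A 0 0)]
  refine ⟨hc, ?_, by linarith⟩
  have : A 1 0 * (A 0 0 + A 1 1) = 0 := by linear_combination h10
  linarith [(mul_eq_zero.mp this).resolve_left hc]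

theorem conj (hA : IsEllipticOrderTwo A) (hB : IsEllipticOrderTwo B) :
    IsEllipticOrderTwo (A * B * A) := by
  unfold IsEllipticOrderTwo at *
  calc A * B * A * (A * B * A) = A * B * (A * A) * B * A := by group
    _ = -(A * (B * B) * A) := by rw [hA]; simp [mul_assoc]
    _ = -1 := by rw [hB]; simp [hA]

theorem shift (hA : IsEllipticOrderTwo A) (a : ℝ) : IsEllipticOrderTwo (shift a A) := by
  unfold IsEllipticOrderTwo at *
  calc Uplift.shift a A * Uplift.shift a A
      = translation a * (A * A) * (translation a)⁻¹ := by unfold Uplift.shift; group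
    _ = -1 := by rw [hA]; simp

end IsEllipticOrderTwo

theorem invHeight_eq (A : SL2R) : invHeight A = |A 1 0| := by
  simp [invHeight, fixedPoint]

theorem one_div_sq_eq (A : SL2R) : 1 / (A 1 0) ^ 2 = 1 / invHeight A ^ 2 := by
  rw [invHeight_eq, sq_abs]

theorem fixedPoint_snd (A : SL2R) : (fixedPoint A).2 = 1 / invHeight A := by
  simp [invHeight]

theorem IsEllipticOrderTwo.invHeight_pos {A : SL2R} (hA : IsEllipticOrderTwo A) :
    0 < invHeight A := by
  rw [invHeight_eq]
  exact abs_pos.mpr hA.entries.1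

theorem shift_entries (a : ℝ) (A : SL2R) :
    shift a A 1 0 = A 1 0 ∧ shift a A 0 0 = A 0 0 + a * A 1 0 := by
  have h : shift a A * translation a = translation a * A := by simp [shift]
  have h' := congrArg (fun B : SL2R => (B : Matrix (Fin 2) (Fin 2) ℝ)) h
  have h00 := congrFun (congrFun h' 0) 0
  have h10 := congrFun (congrFun h' 1) 0
  simp only [Matrix.SpecialLinearGroup.coe_mul, Matrix.mul_apply, Fin.sum_univ_two] at h00 h10
  simp [translation] at h00 h10
  exact ⟨h10, h00⟩

@[simp] theorem invHeight_shift (a : ℝ) (A : SL2R) : invHeight (shift a A) = invHeight A := by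
  rw [invHeight_eq, invHeight_eq, (shift_entries a A).1]

theorem center_shift {A : SL2R} (hA : IsEllipticOrderTwo A) (a : ℝ) :
    center (shift a A) = center A + a := by
  rw [center, center, (shift_entries a A).1, (shift_entries a A).2]
  have := hA.entries.1
  field_simp

/-! ### Factorizations -/

namespace Triple.IsFactorization

variable {a : ℝ} {N : Triple}

theorem lam (hN : N.IsFactorization a) : N.lam.IsFactorization a := by
  refine ⟨hN.orderTwo_E.conj hN.orderTwo_F, hN.orderTwo_E, hN.orderTwo_G, ?_⟩
  have hE : N.E * N.E = -1 := hN.orderTwo_E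
  have : N.lam.G * N.lam.F * N.lam.E = -(N.G * N.F * N.E) := by
    calc N.G * N.E * (N.E * N.F * N.E) = N.G * (N.E * N.E) * N.F * N.E := by group
      _ = _ := by rw [hE]; simp
  rw [this]
  rcases hN.factorization with h | h
  · right; rw [h]
  · left; rw [h, neg_neg]

theorem rho (hN : N.IsFactorization a) : (N.rho a).IsFactorization a := by
  refine ⟨hN.orderTwo_F.conj hN.orderTwo_G, hN.orderTwo_F, hN.orderTwo_E.shift a, ?_⟩
  have hE : N.E * N.E = -1 := hN.orderTwo_E
  have hF : N.F * N.F = -1 := hN.orderTwo_F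
  have hmid : (N.rho a).G * (N.rho a).F * (N.rho a).E * N.E =
      -(translation a * N.E * (translation a)⁻¹ * (N.G * N.F * N.E)) := by
    calc translation a * N.E * (translation a)⁻¹ * N.F * (N.F * N.G * N.F) * N.E
        = translation a * N.E * (translation a)⁻¹ * (N.F * N.F) * (N.G * N.F * N.E) := by group
      _ = _ := by rw [hF]; simp
  have key : ∀ W V : SL2R, W * N.E = V * N.E → W = V := fun W V h => mul_right_cancel h
  rcases hN.factorization with h | h
  · right
    apply key
    rw [hmid, h]
    simp
  · left
    apply key
    rw [hmid, h]
    simp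

/-- The distances between the centres, up to a common sign `τ`. -/
theorem exists_sign (hN : N.IsFactorization a) : ∃ τ : ℝ, (τ = 1 ∨ τ = -1) ∧
    N.G 1 0 * N.F 1 0 * (center N.G - center N.F) = τ * N.E 1 0 ∧
    N.F 1 0 * N.E 1 0 * (center N.F - center N.E) = τ * N.G 1 0 ∧
    N.E 1 0 * N.G 1 0 * (center N.E + a - center N.G) = τ * N.F 1 0 := by
  obtain ⟨hE0, hE1, -⟩ := hN.orderTwo_E.entries
  obtain ⟨hF0, hF1, -⟩ := hN.orderTwo_F.entries
  obtain ⟨hG0, hG1, -⟩ := hN.orderTwo_G.entries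
  have coe : ∀ B C : SL2R, B = C → (B : Matrix (Fin 2) (Fin 2) ℝ) = C := fun _ _ h => by rw [h]
  obtain ⟨E, F, G⟩ := N
  dsimp only at *
  set S := translation a with hS
  have hcS : (S : Matrix (Fin 2) (Fin 2) ℝ) = !![1, a; 0, 1] := rfl
  have hE : E * E = -1 := hN.orderTwo_E
  have hF : F * F = -1 := hN.orderTwo_F
  have hG : G * G = -1 := hN.orderTwo_G
  have hS' : ((S⁻¹ : SL2R) : Matrix (Fin 2) (Fin 2) ℝ) = !![1, -a; 0, 1] := by
    rw [Matrix.SpecialLinearGroup.coe_inv, hcS, Matrix.adjugate_fin_two_of]; simp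
  have hmove : ∀ T : SL2R, G * F * E = T → G * F = -(T * E) ∧ F * E = -(G * T) ∧
      E * T⁻¹ * G = -F := by
    intro T hT
    refine ⟨by rw [← hT, mul_assoc (G * F), hE]; simp,
      by rw [← hT, mul_assoc G F E, ← mul_assoc G G, hG]; simp, ?_⟩
    have h1 : E = -(F * (F * E)) := by rw [← mul_assoc, hF]; simp
    have h2 : F * E = -(G * T) := by rw [← hT, mul_assoc G F E, ← mul_assoc G G, hG]; simp
    rw [h1, h2]
    simp [mul_assoc, hG]
  -- τ is the sign in GFE = τS^a. The lower-left entries of these three rearrangements give the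
  -- three distances.
  have hex : ∃ τ : ℝ, (τ = 1 ∨ τ = -1) ∧
      (G * F : Matrix (Fin 2) (Fin 2) ℝ) = -(τ • (!![1, a; 0, 1] * E)) ∧
      (F * E : Matrix (Fin 2) (Fin 2) ℝ) = -(τ • (G * !![1, a; 0, 1])) ∧
      (E * !![1, -a; 0, 1] * G : Matrix (Fin 2) (Fin 2) ℝ) = -(τ • F) := by
    rcases hN.factorization with h | h
    · obtain ⟨h1, h2, h3⟩ := hmove _ h
      refine ⟨1, Or.inl rfl, ?_, ?_, ?_⟩
      · simpa [← hS, hcS] using coe _ _ h1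
      · simpa [← hS, hcS] using coe _ _ h2
      · have := coe _ _ h3
        rw [Matrix.SpecialLinearGroup.coe_mul, Matrix.SpecialLinearGroup.coe_mul, hS'] at this
        simpa using this
    · obtain ⟨h1, h2, h3⟩ := hmove _ h
      rw [inv_neg] at h3
      refine ⟨-1, Or.inr rfl, ?_, ?_, ?_⟩
      · simpa [← hS, hcS] using coe _ _ h1
      · simpa [← hS, hcS] using coe _ _ h2
      · have := coe _ _ h3
        rw [Matrix.SpecialLinearGroup.coe_mul, Matrix.SpecialLinearGroup.coe_mul,
          Matrix.SpecialLinearGroup.coe_neg, Matrix.SpecialLinearGroup.coe_neg, hS'] at this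
        rw [mul_neg, neg_mul, neg_inj] at this
        simpa using this
  obtain ⟨τ, hτ, h1, h2, h3⟩ := hex
  have e1 := congrFun (congrFun h1 1) 0
  have e2 := congrFun (congrFun h2 1) 0
  have e3 := congrFun (congrFun h3 1) 0
  simp [Matrix.mul_apply, Fin.sum_univ_two, hE1, hF1, hG1, Matrix.vecMul, dotProduct] at e1 e2 e3
  refine ⟨τ, hτ, ?_, ?_, ?_⟩
  · rw [center, center]
    field_simp
    linear_combination -e1
  · rw [center, center]
    field_simp
    linear_combination -e2
  · rw [center, center]
    field_simp
    linear_combination -e3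

theorem invHeight_pos (hN : N.IsFactorization a) :
    0 < invHeight N.G ∧ 0 < invHeight N.F ∧ 0 < invHeight N.E :=
  ⟨hN.orderTwo_G.invHeight_pos, hN.orderTwo_F.invHeight_pos, hN.orderTwo_E.invHeight_pos⟩

theorem markov_and_centers (ha : 0 < a) (hN : N.IsFactorization a) :
    invHeight N.G ^ 2 + invHeight N.F ^ 2 + invHeight N.E ^ 2 =
        a * invHeight N.G * invHeight N.F * invHeight N.E ∧
      center N.F = center N.E + invHeight N.G / (invHeight N.F * invHeight N.E) ∧
      center N.G = center N.E + a - invHeight N.F / (invHeight N.G * invHeight N.E) := by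
  obtain ⟨τ, hτ, h1, h2, h3⟩ := hN.exists_sign
  have hE0 := hN.orderTwo_E.entries.1
  have hF0 := hN.orderTwo_F.entries.1
  have hG0 := hN.orderTwo_G.entries.1
  simp only [invHeight_eq]
  set e := N.E 1 0
  set f := N.F 1 0
  set g := N.G 1 0
  have hττ : τ * τ = 1 := by rcases hτ with rfl | rfl <;> norm_num
  -- The three distances telescope to a. The sum of squares is positive and a > 0, so τ is the sign
  -- of gfe.
  have hsum : e ^ 2 + f ^ 2 + g ^ 2 = a * (τ * (g * f * e)) := by
    linear_combination (-τ) * e * h1 - τ * g * h2 - τ * f * h3 - (e ^ 2 + f ^ 2 + g ^ 2) * hττ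
  have hpos : 0 < τ * (g * f * e) := by
    have : 0 < e ^ 2 + f ^ 2 + g ^ 2 := by positivity
    rw [hsum] at this
    exact pos_of_mul_pos_right this ha.le
  have habs : τ * (g * f * e) = |g| * |f| * |e| := by
    rw [← abs_of_pos hpos, abs_mul, abs_mul, abs_mul]
    rcases hτ with rfl | rfl <;> simp
  have hg := abs_pos.mpr hG0
  have hf := abs_pos.mpr hF0
  have he := abs_pos.mpr hE0
  refine ⟨?_, ?_, ?_⟩
  · rw [sq_abs, sq_abs, sq_abs]
    linear_combination hsum + a * habs
  · suffices center N.F - center N.E = |g| / (|f| * |e|) by linarith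
    rw [eq_div_iff (by positivity)]
    apply mul_left_cancel₀ hg.ne'
    have : |g| * |g| = g * g := abs_mul_abs_self g
    linear_combination (-(center N.F - center N.E)) * habs + τ * g * h2 + g ^ 2 * hττ - this
  · suffices center N.E + a - center N.G = |f| / (|g| * |e|) by linarith
    rw [eq_div_iff (by positivity)]
    apply mul_left_cancel₀ hf.ne'
    have : |f| * |f| = f * f := abs_mul_abs_self f
    linear_combination (-(center N.E + a - center N.G)) * habs + τ * f * h3 + f ^ 2 * hττ - this

end Triple.IsFactorization

/-! ### Reduced triples and their children -/

/-- A factorization whose first fixed point is the lowest of the three. -/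
structure Triple.IsReduced (a : ℝ) (N : Triple) : Prop where
  isFactorization : N.IsFactorization a
  G_le : invHeight N.G ≤ invHeight N.E
  F_le : invHeight N.F ≤ invHeight N.E

namespace Triple

variable {a : ℝ} {N : Triple}

theorem lam_G (N : Triple) : N.lam.G = N.G := rfl
theorem lam_F (N : Triple) : N.lam.F = N.E := rfl
theorem rho_G (a : ℝ) (N : Triple) : (N.rho a).G = shift a N.E := rfl
theorem rho_F (a : ℝ) (N : Triple) : (N.rho a).F = N.F := rfl

/-- A Vieta jump: λ keeps the fixed points of E and G, so their distance computed from N and from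
`N.lam` agrees. Together with the Markov equation of `N.lam` this determines the new value. -/
theorem IsFactorization.invHeight_lam (ha : 0 < a) (hN : N.IsFactorization a) :
    invHeight N.lam.E = a * invHeight N.G * invHeight N.E - invHeight N.F := by
  obtain ⟨hm, hF, hG⟩ := hN.markov_and_centers ha
  obtain ⟨hm', hF', hG'⟩ := hN.lam.markov_and_centers ha
  obtain ⟨hx, hy, hz⟩ := hN.invHeight_pos
  have hw := hN.lam.invHeight_pos.2.2
  rw [lam_G, lam_F] at *
  rw [hF', hG'] at hG
  generalize invHeight N.lam.E = w at *
  field_simp at hG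
  have : w * (w - (a * invHeight N.G * invHeight N.E - invHeight N.F)) = 0 := by
    linear_combination hG + hm'
  linarith [(mul_eq_zero.mp this).resolve_left hw.ne']

theorem IsFactorization.invHeight_rho (ha : 0 < a) (hN : N.IsFactorization a) :
    invHeight (N.rho a).E = a * invHeight N.F * invHeight N.E - invHeight N.G := by
  obtain ⟨hm, hF, hG⟩ := hN.markov_and_centers ha
  obtain ⟨hm', hF', hG'⟩ := hN.rho.markov_and_centers ha
  obtain ⟨hx, hy, hz⟩ := hN.invHeight_pos
  have hw := hN.rho.invHeight_pos.2.2
  rw [rho_G, rho_F, invHeight_shift] at *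
  rw [center_shift hN.orderTwo_E] at hG'
  have h1 : center N.E + a - center N.F = a - invHeight N.G / (invHeight N.F * invHeight N.E) := by
    rw [hF]; ring
  rw [hF', hG'] at h1
  generalize invHeight (N.rho a).E = w at *
  field_simp at h1
  have : w * (w - (a * invHeight N.F * invHeight N.E - invHeight N.G)) = 0 := by
    linear_combination h1 + hm'
  linarith [(mul_eq_zero.mp this).resolve_left hw.ne']

namespace IsReduced

/-- The new value and y are the two roots of one quadratic, and this is their product. -/
theorem invHeight_lam_mul (ha : 0 < a) (hN : N.IsReduced a) :
    invHeight N.lam.E * invHeight N.F = invHeight N.G ^ 2 + invHeight N.E ^ 2 := by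
  rw [hN.isFactorization.invHeight_lam ha]
  linear_combination -(hN.isFactorization.markov_and_centers ha).1

theorem invHeight_rho_mul (ha : 0 < a) (hN : N.IsReduced a) :
    invHeight (N.rho a).E * invHeight N.G = invHeight N.F ^ 2 + invHeight N.E ^ 2 := by
  rw [hN.isFactorization.invHeight_rho ha]
  linear_combination -(hN.isFactorization.markov_and_centers ha).1

theorem lt_invHeight_lam (ha : 0 < a) (hN : N.IsReduced a) :
    invHeight N.E < invHeight N.lam.E := by
  obtain ⟨hx, hy, hz⟩ := hN.isFactorization.invHeight_pos
  have h := hN.invHeight_lam_mul ha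
  have := hN.F_le
  by_contra! hc
  nlinarith

theorem lt_invHeight_rho (ha : 0 < a) (hN : N.IsReduced a) :
    invHeight N.E < invHeight (N.rho a).E := by
  obtain ⟨hx, hy, hz⟩ := hN.isFactorization.invHeight_pos
  have h := hN.invHeight_rho_mul ha
  have := hN.G_le
  by_contra! hc
  nlinarith

theorem lam (ha : 0 < a) (hN : N.IsReduced a) : N.lam.IsReduced a :=
  ⟨hN.isFactorization.lam, hN.G_le.trans (hN.lt_invHeight_lam ha).le, (hN.lt_invHeight_lam ha).le⟩

theorem rho (ha : 0 < a) (hN : N.IsReduced a) : (N.rho a).IsReduced a :=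
  ⟨hN.isFactorization.rho, by
    rw [rho_G, invHeight_shift]; exact (hN.lt_invHeight_rho ha).le,
    hN.F_le.trans (hN.lt_invHeight_rho ha).le⟩

/-- The left side is the product of the new value with the smaller y. The inequality thus holds at
every child, even when it fails at the root. -/
theorem sq_add_sq_le_lam (ha : 0 < a) (hN : N.IsReduced a) :
    invHeight N.lam.G ^ 2 + invHeight N.lam.F ^ 2 ≤ invHeight N.lam.E ^ 2 := by
  rw [lam_G, lam_F, ← hN.invHeight_lam_mul ha, sq]
  have := hN.lam ha |>.isFactorization.invHeight_pos.2.2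
  exact mul_le_mul_of_nonneg_left (hN.F_le.trans (hN.lt_invHeight_lam ha).le) this.le

theorem sq_add_sq_le_rho (ha : 0 < a) (hN : N.IsReduced a) :
    invHeight (N.rho a).G ^ 2 + invHeight (N.rho a).F ^ 2 ≤ invHeight (N.rho a).E ^ 2 := by
  rw [rho_G, rho_F, invHeight_shift, add_comm, ← hN.invHeight_rho_mul ha, sq]
  have := hN.rho ha |>.isFactorization.invHeight_pos.2.2
  exact mul_le_mul_of_nonneg_left (hN.G_le.trans (hN.lt_invHeight_rho ha).le) this.le

theorem of_inTree (ha : 0 < a) (hN : N.IsReduced a) {M : Triple} (hM : InTree a N M) :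
    M.IsReduced a := by
  induction hM with
  | root => exact hN
  | lam M _ ih => exact ih.lam ha
  | rho M _ ih => exact ih.rho ha

theorem invHeight_le_of_inTree (ha : 0 < a) (hN : N.IsReduced a) {M : Triple}
    (hM : InTree a N M) : invHeight N.E ≤ invHeight M.E := by
  induction hM with
  | root => exact le_rfl
  | lam M hM ih => exact ih.trans ((hN.of_inTree ha hM).lt_invHeight_lam ha).le
  | rho M hM ih => exact ih.trans ((hN.of_inTree ha hM).lt_invHeight_rho ha).le

end IsReduced

end Triple

/-- `InTree` adds moves at the end; the recursion on slices has to split off the first move. -/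
theorem inTree_iff {a : ℝ} {N M : Triple} :
    InTree a N M ↔ M = N ∨ InTree a N.lam M ∨ InTree a (N.rho a) M := by
  constructor
  · intro h
    induction h with
    | root => exact Or.inl rfl
    | lam M _ ih =>
      rcases ih with rfl | h | h
      · exact Or.inr (Or.inl .root)
      · exact Or.inr (Or.inl (.lam _ h))
      · exact Or.inr (Or.inr (.lam _ h))
    | rho M _ ih =>
      rcases ih with rfl | h | h
      · exact Or.inr (Or.inr .root)
      · exact Or.inr (Or.inl (.rho _ h))
      · exact Or.inr (Or.inr (.rho _ h))
  · rintro (rfl | h | h)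
    · exact .root
    · induction h with
      | root => exact .lam _ .root
      | lam M _ ih => exact .lam _ ih
      | rho M _ ih => exact .rho _ ih
    · induction h with
      | root => exact .rho _ .root
      | lam M _ ih => exact .lam _ ih
      | rho M _ ih => exact .rho _ ih

/-! ### Horizontal slices of the uplift regions -/

/-- Abscissa of the lower boundary of `U₋(A)` at height `Y`. -/
def leftOuter (A : SL2R) (Y : ℝ) : ℝ := center A - √(Y ^ 2 + 1 / invHeight A ^ 2)
/-- Abscissa of the left branch of the upper boundary of `U(A)` at height `Y`. -/
def leftInner (A : SL2R) (Y : ℝ) : ℝ := center A - √(Y ^ 2 - 1 / invHeight A ^ 2)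
/-- Abscissa of the right branch of the upper boundary of `U(A)` at height `Y`. -/
def rightInner (A : SL2R) (Y : ℝ) : ℝ := center A + √(Y ^ 2 - 1 / invHeight A ^ 2)
/-- Abscissa of the lower boundary of `U₊(A)` at height `Y`. -/
def rightOuter (A : SL2R) (Y : ℝ) : ℝ := center A + √(Y ^ 2 + 1 / invHeight A ^ 2)

theorem continuous_leftOuter (A : SL2R) : Continuous (leftOuter A) := by
  unfold leftOuter; fun_prop
theorem continuous_leftInner (A : SL2R) : Continuous (leftInner A) := by
  unfold leftInner; fun_prop
theorem continuous_rightInner (A : SL2R) : Continuous (rightInner A) := by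
  unfold rightInner; fun_prop
theorem continuous_rightOuter (A : SL2R) : Continuous (rightOuter A) := by
  unfold rightOuter; fun_prop

section Slices

variable {A : SL2R} {X Y : ℝ}

theorem mem_upliftMinus_iff (hY : 0 < Y) :
    (X, Y) ∈ upliftMinus A ↔ leftOuter A Y < X ∧ X < leftInner A Y := by
  simp only [upliftMinus, upliftRegion, mem_ofPred_eq, one_div_sq_eq, abs_lt, hY, true_and,
    leftOuter, leftInner]
  set q := 1 / invHeight A ^ 2
  set c := center A
  constructor
  · rintro ⟨⟨h1, h2⟩, h3⟩
    have h4 : c - X < √(Y ^ 2 + q) := Real.lt_sqrt_of_sq_lt (by nlinarith)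
    have h5 : √(Y ^ 2 - q) < c - X := (Real.sqrt_lt' (by linarith)).2 (by nlinarith)
    constructor <;> linarith
  · rintro ⟨h1, h2⟩
    have h0 := Real.sqrt_nonneg (Y ^ 2 - q)
    have h4 : (c - X) ^ 2 < Y ^ 2 + q := (Real.lt_sqrt (by linarith)).1 (by linarith)
    have h5 : Y ^ 2 - q < (c - X) ^ 2 := (Real.sqrt_lt' (by linarith)).1 (by linarith)
    refine ⟨⟨?_, ?_⟩, ?_⟩ <;> nlinarith

/-- The bound on Y matters: below the fixed point U₊ contains the line X = center, which the strict
inequality at `rightInner` (where `√` is 0) would exclude. U₋ has no such problem, since X < center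
is strict. -/
theorem mem_upliftPlus_iff (hY : 0 < Y) (hA : 1 / invHeight A ^ 2 ≤ Y ^ 2) :
    (X, Y) ∈ upliftPlus A ↔ rightInner A Y < X ∧ X < rightOuter A Y := by
  simp only [upliftPlus, upliftRegion, mem_ofPred_eq, one_div_sq_eq, abs_lt, hY, true_and,
    rightOuter, rightInner]
  set q := 1 / invHeight A ^ 2
  set c := center A
  constructor
  · rintro ⟨⟨h1, h2⟩, h3⟩
    have h4 : X - c < √(Y ^ 2 + q) := Real.lt_sqrt_of_sq_lt (by nlinarith)
    have h6 : X - c ≠ 0 := by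
      intro h
      rw [h] at h1
      linarith
    have h7 : 0 < X - c := lt_of_le_of_ne (by linarith) h6.symm
    have h5 : √(Y ^ 2 - q) < X - c := (Real.sqrt_lt' h7).2 (by linarith)
    constructor <;> linarith
  · rintro ⟨h1, h2⟩
    have h0 := Real.sqrt_nonneg (Y ^ 2 - q)
    have h4 : (X - c) ^ 2 < Y ^ 2 + q := (Real.lt_sqrt (by linarith)).1 (by linarith)
    have h5 : Y ^ 2 - q < (X - c) ^ 2 := (Real.sqrt_lt' (by linarith)).1 (by linarith)
    refine ⟨⟨?_, ?_⟩, ?_⟩ <;> linarith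

theorem mem_lowerBoundaryMinus_iff (hA : IsEllipticOrderTwo A) (hY : 0 < Y) :
    (X, Y) ∈ lowerBoundaryMinus A ↔ X = leftOuter A Y := by
  have hq : 0 < 1 / invHeight A ^ 2 := by have := hA.invHeight_pos; positivity
  simp only [lowerBoundaryMinus, lowerBoundary, mem_ofPred_eq, one_div_sq_eq, hY, true_and,
    leftOuter]
  set q := 1 / invHeight A ^ 2
  constructor
  · rintro ⟨h1, h2⟩
    have : √(Y ^ 2 + q) = center A - X := by
      rw [Real.sqrt_eq_iff_mul_self_eq (by positivity) (by linarith)]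
      linarith
    linarith
  · rintro rfl
    have := Real.sq_sqrt (show 0 ≤ Y ^ 2 + q by positivity)
    have := Real.sqrt_pos.2 (show 0 < Y ^ 2 + q by positivity)
    constructor <;> linarith

theorem mem_lowerBoundaryPlus_iff (hA : IsEllipticOrderTwo A) (hY : 0 < Y) :
    (X, Y) ∈ lowerBoundaryPlus A ↔ X = rightOuter A Y := by
  have hq : 0 < 1 / invHeight A ^ 2 := by have := hA.invHeight_pos; positivity
  simp only [lowerBoundaryPlus, lowerBoundary, mem_ofPred_eq, one_div_sq_eq, hY, true_and,
    rightOuter]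
  set q := 1 / invHeight A ^ 2
  constructor
  · rintro ⟨h1, h2⟩
    have : √(Y ^ 2 + q) = X - center A := by
      rw [Real.sqrt_eq_iff_mul_self_eq (by positivity) (by linarith)]
      linarith
    linarith
  · rintro rfl
    have := Real.sq_sqrt (show 0 ≤ Y ^ 2 + q by positivity)
    have := Real.sqrt_pos.2 (show 0 < Y ^ 2 + q by positivity)
    constructor <;> linarith

theorem leftOuter_lt_leftInner (hA : IsEllipticOrderTwo A) (hY : 0 < Y) :
    leftOuter A Y < leftInner A Y := by
  have hq : 0 < 1 / invHeight A ^ 2 := by have := hA.invHeight_pos; positivity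
  have : √(Y ^ 2 - 1 / invHeight A ^ 2) < √(Y ^ 2 + 1 / invHeight A ^ 2) :=
    (Real.sqrt_lt_sqrt_iff_of_pos (by positivity)).2 (by linarith)
  unfold leftOuter leftInner
  linarith

theorem rightInner_lt_rightOuter (hA : IsEllipticOrderTwo A) (hY : 0 < Y) :
    rightInner A Y < rightOuter A Y := by
  have hq : 0 < 1 / invHeight A ^ 2 := by have := hA.invHeight_pos; positivity
  have : √(Y ^ 2 - 1 / invHeight A ^ 2) < √(Y ^ 2 + 1 / invHeight A ^ 2) :=
    (Real.sqrt_lt_sqrt_iff_of_pos (by positivity)).2 (by linarith)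
  unfold rightOuter rightInner
  linarith

end Slices

/-! ### Order of the boundary curves of a reduced triple -/

namespace Triple

/-- Abscissa of the apex of the geodesic through the fixed points of `G` and `F`. -/
def apexX (a : ℝ) (N : Triple) : ℝ := center N.E + a / 2

/-- Squared height of that apex. -/
def apexSq (a : ℝ) (N : Triple) : ℝ := a ^ 2 / 4 - 1 / invHeight N.E ^ 2

namespace IsReduced

variable {a Y : ℝ} {N : Triple}

theorem markov_symm (ha : 0 < a) (hN : N.IsReduced a) :
    invHeight N.F ^ 2 + invHeight N.G ^ 2 + invHeight N.E ^ 2 =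
      a * invHeight N.F * invHeight N.G * invHeight N.E := by
  linear_combination (hN.isFactorization.markov_and_centers ha).1

theorem one_div_le_apexSq (ha : 0 < a) (hN : N.IsReduced a) :
    1 / invHeight N.G ^ 2 < N.apexSq a ∧ 1 / invHeight N.F ^ 2 < N.apexSq a ∧
      1 / invHeight N.E ^ 2 ≤ 1 / invHeight N.G ^ 2 ∧
      1 / invHeight N.E ^ 2 ≤ 1 / invHeight N.F ^ 2 := by
  obtain ⟨hx, hy, hz⟩ := hN.isFactorization.invHeight_pos
  have h := (hN.isFactorization.markov_and_centers ha).1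
  have h1 := sq_half_sub_div hx hz h
  have h2 := sq_half_sub_div hy hz (hN.markov_symm ha)
  have h3 := half_sub_div_pos hx hy hz h hN.F_le
  have h4 := half_sub_div_pos hy hx hz (hN.markov_symm ha) hN.G_le
  have := hN.G_le
  have := hN.F_le
  refine ⟨?_, ?_, by gcongr, by gcongr⟩ <;> unfold apexSq
  · linarith [pow_pos h3 2]
  · linarith [pow_pos h4 2]

theorem one_div_le_of_apexSq_le (ha : 0 < a) (hN : N.IsReduced a) (hY : N.apexSq a ≤ Y ^ 2) :
    1 / invHeight N.G ^ 2 ≤ Y ^ 2 ∧ 1 / invHeight N.F ^ 2 ≤ Y ^ 2 ∧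
      1 / invHeight N.E ^ 2 ≤ Y ^ 2 := by
  obtain ⟨h1, h2, h3, h4⟩ := hN.one_div_le_apexSq ha
  refine ⟨?_, ?_, ?_⟩ <;> linarith

theorem apexSq_pos (ha : 0 < a) (hN : N.IsReduced a) : 0 < N.apexSq a := by
  obtain ⟨hx, -, -⟩ := hN.isFactorization.invHeight_pos
  exact lt_trans (by positivity) (hN.one_div_le_apexSq ha).1

theorem apexSq_lt (hN : N.IsReduced a) : N.apexSq a < a ^ 2 / 4 := by
  obtain ⟨-, -, hz⟩ := hN.isFactorization.invHeight_pos
  have : 0 < 1 / invHeight N.E ^ 2 := by positivity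
  unfold apexSq
  linarith

theorem apexSq_lt_lam (ha : 0 < a) (hN : N.IsReduced a) : N.apexSq a < N.lam.apexSq a := by
  obtain ⟨-, -, hz⟩ := hN.isFactorization.invHeight_pos
  have := hN.lt_invHeight_lam ha
  have : 1 / invHeight N.lam.E ^ 2 < 1 / invHeight N.E ^ 2 := by gcongr
  unfold apexSq
  linarith

theorem apexSq_lt_rho (ha : 0 < a) (hN : N.IsReduced a) :
    N.apexSq a < (N.rho a).apexSq a := by
  obtain ⟨-, -, hz⟩ := hN.isFactorization.invHeight_pos
  have := hN.lt_invHeight_rho ha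
  have : 1 / invHeight (N.rho a).E ^ 2 < 1 / invHeight N.E ^ 2 := by gcongr
  unfold apexSq
  linarith

theorem inner_of_apexSq_le (ha : 0 < a) (hN : N.IsReduced a) (hY : N.apexSq a ≤ Y ^ 2) :
    leftInner N.G Y ≤ N.apexX a ∧ N.apexX a ≤ rightInner N.F Y := by
  obtain ⟨hx, hy, hz⟩ := hN.isFactorization.invHeight_pos
  obtain ⟨h, hF, hG⟩ := hN.isFactorization.markov_and_centers ha
  have h1 := half_sub_div_le_sqrt hx hz h hY
  have h2 := half_sub_div_le_sqrt hy hz (hN.markov_symm ha) hY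
  unfold leftInner rightInner apexX
  rw [hF, hG]
  constructor <;> linarith

theorem inner_of_apexSq_lt (ha : 0 < a) (hN : N.IsReduced a) (hY : N.apexSq a < Y ^ 2) :
    leftInner N.G Y < N.apexX a ∧ N.apexX a < rightInner N.F Y := by
  obtain ⟨hx, hy, hz⟩ := hN.isFactorization.invHeight_pos
  obtain ⟨h, hF, hG⟩ := hN.isFactorization.markov_and_centers ha
  have h1 := half_sub_div_lt_sqrt hx hz h hY
  have h2 := half_sub_div_lt_sqrt hy hz (hN.markov_symm ha) hY
  unfold leftInner rightInner apexX
  rw [hF, hG]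
  constructor <;> linarith

theorem inner_of_le_apexSq (ha : 0 < a) (hN : N.IsReduced a) (hY : Y ^ 2 ≤ N.apexSq a) :
    N.apexX a ≤ leftInner N.G Y ∧ rightInner N.F Y ≤ N.apexX a := by
  obtain ⟨hx, hy, hz⟩ := hN.isFactorization.invHeight_pos
  obtain ⟨h, hF, hG⟩ := hN.isFactorization.markov_and_centers ha
  have h1 := sqrt_le_half_sub_div hx hy hz h hN.F_le hY
  have h2 := sqrt_le_half_sub_div hy hx hz (hN.markov_symm ha) hN.G_le hY
  unfold leftInner rightInner apexX
  rw [hF, hG]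
  constructor <;> linarith

theorem inner_of_lt_apexSq (ha : 0 < a) (hN : N.IsReduced a) (hY : Y ^ 2 < N.apexSq a) :
    N.apexX a < leftInner N.G Y ∧ rightInner N.F Y < N.apexX a := by
  obtain ⟨hx, hy, hz⟩ := hN.isFactorization.invHeight_pos
  obtain ⟨h, hF, hG⟩ := hN.isFactorization.markov_and_centers ha
  have h1 := sqrt_lt_half_sub_div hx hy hz h hN.F_le hY
  have h2 := sqrt_lt_half_sub_div hy hx hz (hN.markov_symm ha) hN.G_le hY
  unfold leftInner rightInner apexX
  rw [hF, hG]
  constructor <;> linarith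

theorem leftOuter_le_rightInner (ha : 0 < a) (hN : N.IsReduced a)
    (hx' : a ^ 2 / 4 - 1 / invHeight N.G ^ 2 ≤ Y ^ 2) (hz' : 1 / invHeight N.E ^ 2 ≤ Y ^ 2) :
    leftOuter N.G Y ≤ rightInner N.E Y := by
  obtain ⟨hx, hy, hz⟩ := hN.isFactorization.invHeight_pos
  obtain ⟨h, hF, hG⟩ := hN.isFactorization.markov_and_centers ha
  have h1 := sub_div_le_sqrt_add_sqrt hx hy hz h hx' hz'
  unfold leftOuter rightInner
  rw [hG]
  linarith

theorem leftInner_shift_le_rightOuter (ha : 0 < a) (hN : N.IsReduced a)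
    (hy' : a ^ 2 / 4 - 1 / invHeight N.F ^ 2 ≤ Y ^ 2) (hz' : 1 / invHeight N.E ^ 2 ≤ Y ^ 2) :
    leftInner (shift a N.E) Y ≤ rightOuter N.F Y := by
  obtain ⟨hx, hy, hz⟩ := hN.isFactorization.invHeight_pos
  obtain ⟨h, hF, hG⟩ := hN.isFactorization.markov_and_centers ha
  have h1 := sub_div_le_sqrt_add_sqrt hy hx hz (hN.markov_symm ha) hy' hz'
  unfold leftInner rightOuter
  rw [hF, invHeight_shift, center_shift hN.isFactorization.orderTwo_E]
  linarith

theorem rightInner_le_leftOuter_shift (ha : 0 < a) (hN : N.IsReduced a)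
    (hz' : 1 / invHeight N.E ^ 2 ≤ Y ^ 2) (hY : Y ^ 2 ≤ a ^ 2 / 4) :
    rightInner N.E Y ≤ leftOuter (shift a N.E) Y ∧
      rightOuter N.E Y ≤ leftInner (shift a N.E) Y := by
  have h1 := sqrt_sub_add_sqrt_add_le ha.le (by positivity) hz' hY
  unfold leftOuter rightInner rightOuter leftInner
  rw [invHeight_shift, center_shift hN.isFactorization.orderTwo_E]
  constructor <;> linarith

theorem rightInner_lt_apexX (ha : 0 < a) (hN : N.IsReduced a) (hY : Y ^ 2 < a ^ 2 / 4) :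
    rightInner N.E Y < N.apexX a ∧ N.apexX a < leftInner (shift a N.E) Y := by
  obtain ⟨-, -, hz⟩ := hN.isFactorization.invHeight_pos
  have hq : 0 < 1 / invHeight N.E ^ 2 := by positivity
  have : √(Y ^ 2 - 1 / invHeight N.E ^ 2) < a / 2 :=
    (Real.sqrt_lt' (by linarith)).2 (by linarith)
  unfold rightInner leftInner apexX
  rw [invHeight_shift, center_shift hN.isFactorization.orderTwo_E]
  constructor <;> linarith

/-- The two centres are a apart and both curves lie at distance √(Y² + 1/z²) from them, so the
curves pass the midpoint once Y² + 1/z² exceeds a²/4. -/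
theorem outer_of_apexSq_lt (hN : N.IsReduced a) (hY : N.apexSq a < Y ^ 2) :
    N.apexX a < rightOuter N.E Y ∧ leftOuter (shift a N.E) Y < N.apexX a := by
  have : a / 2 < √(Y ^ 2 + 1 / invHeight N.E ^ 2) :=
    Real.lt_sqrt_of_sq_lt (by unfold apexSq at hY; linarith)
  unfold rightOuter leftOuter apexX
  rw [invHeight_shift, center_shift hN.isFactorization.orderTwo_E]
  constructor <;> linarith

theorem outer_of_le_apexSq (ha : 0 < a) (hN : N.IsReduced a) (hY : Y ^ 2 ≤ N.apexSq a) :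
    rightOuter N.E Y ≤ N.apexX a ∧ N.apexX a ≤ leftOuter (shift a N.E) Y := by
  have : √(Y ^ 2 + 1 / invHeight N.E ^ 2) ≤ a / 2 :=
    (Real.sqrt_le_left (by linarith)).2 (by unfold apexSq at hY; linarith)
  unfold rightOuter leftOuter apexX
  rw [invHeight_shift, center_shift hN.isFactorization.orderTwo_E]
  constructor <;> linarith

theorem rightInner_F_le_E (ha : 0 < a) (hN : N.IsReduced a)
    (hxyz : invHeight N.G ^ 2 + invHeight N.F ^ 2 ≤ invHeight N.E ^ 2)
    (hY : Y ^ 2 ≤ a ^ 2 / 4 - 1 / invHeight N.G ^ 2) (hy' : 1 / invHeight N.F ^ 2 ≤ Y ^ 2) :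
    rightInner N.F Y ≤ rightInner N.E Y := by
  obtain ⟨hx, hy, hz⟩ := hN.isFactorization.invHeight_pos
  obtain ⟨h, hF, hG⟩ := hN.isFactorization.markov_and_centers ha
  have := sqrt_add_div_le_sqrt hx hy hz h hxyz hY hy'
  unfold rightInner
  rw [hF]
  linarith

theorem leftInner_shift_le_G (ha : 0 < a) (hN : N.IsReduced a)
    (hxyz : invHeight N.G ^ 2 + invHeight N.F ^ 2 ≤ invHeight N.E ^ 2)
    (hY : Y ^ 2 ≤ a ^ 2 / 4 - 1 / invHeight N.F ^ 2) (hx' : 1 / invHeight N.G ^ 2 ≤ Y ^ 2) :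
    leftInner (shift a N.E) Y ≤ leftInner N.G Y := by
  obtain ⟨hx, hy, hz⟩ := hN.isFactorization.invHeight_pos
  obtain ⟨h, hF, hG⟩ := hN.isFactorization.markov_and_centers ha
  have := sqrt_add_div_le_sqrt hy hx hz (hN.markov_symm ha) (by linarith) hY hx'
  unfold leftInner
  rw [hG, invHeight_shift, center_shift hN.isFactorization.orderTwo_E]
  linarith

theorem outer_le_outer (ha : 0 < a) (hN : N.IsReduced a) (Y : ℝ) :
    rightOuter N.E Y ≤ rightOuter N.F Y ∧ leftOuter N.G Y ≤ leftOuter (shift a N.E) Y := by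
  obtain ⟨hx, hy, hz⟩ := hN.isFactorization.invHeight_pos
  obtain ⟨h, hF, hG⟩ := hN.isFactorization.markov_and_centers ha
  obtain ⟨-, -, h3, h4⟩ := hN.one_div_le_apexSq ha
  have h1 : √(Y ^ 2 + 1 / invHeight N.E ^ 2) ≤ √(Y ^ 2 + 1 / invHeight N.F ^ 2) :=
    Real.sqrt_le_sqrt (by linarith)
  have h2 : √(Y ^ 2 + 1 / invHeight N.E ^ 2) ≤ √(Y ^ 2 + 1 / invHeight N.G ^ 2) :=
    Real.sqrt_le_sqrt (by linarith)
  have h5 : 0 ≤ invHeight N.G / (invHeight N.F * invHeight N.E) := by positivity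
  have h6 : 0 ≤ invHeight N.F / (invHeight N.G * invHeight N.E) := by positivity
  unfold leftOuter rightOuter
  rw [hF, hG, invHeight_shift, center_shift hN.isFactorization.orderTwo_E]
  constructor <;> linarith

end IsReduced

end Triple

/-! ### Apexes -/

theorem IsApex.symm {A B : SL2R} {p : ℝ × ℝ} (h : IsApex A B p) : IsApex B A p :=
  ⟨h.1, h.2.1.symm, h.2.2.2, h.2.2.1⟩

theorem IsApex.bifurcate {A B : SL2R} {p : ℝ × ℝ} (h : IsApex A B p) : Bifurcate A B p := by
  obtain ⟨hp, -, hA, hB⟩ := h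
  rw [fixedPoint_snd, div_pow, one_pow] at hA hB
  simp only [fixedPoint] at hA hB
  refine ⟨⟨hp, ?_⟩, ⟨hp, ?_⟩⟩ <;> rw [one_div_sq_eq] <;> linarith

/-- The apexes attached to the triples of the tree of `N`, including `N` itself. -/
def apexes (a : ℝ) (N : Triple) : Set (ℝ × ℝ) :=
  {p | ∃ M, InTree a N M ∧ IsApex M.G M.F p}

theorem treePunctures_eq (a : ℝ) (N : Triple) :
    treePunctures a N = apexes a N.lam ∪ apexes a (N.rho a) := by
  ext p
  constructor
  · rintro ⟨M, hM | hM, hp⟩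
    · exact Or.inl ⟨M, hM, hp⟩
    · exact Or.inr ⟨M, hM, hp⟩
  · rintro (⟨M, hM, hp⟩ | ⟨M, hM, hp⟩)
    · exact ⟨M, Or.inl hM, hp⟩
    · exact ⟨M, Or.inr hM, hp⟩

theorem mem_apexes_iff {a : ℝ} {N : Triple} {p : ℝ × ℝ} :
    p ∈ apexes a N ↔ IsApex N.G N.F p ∨ p ∈ treePunctures a N := by
  rw [treePunctures_eq]
  constructor
  · rintro ⟨M, hM, hp⟩
    rcases inTree_iff.1 hM with rfl | h | h
    · exact Or.inl hp
    · exact Or.inr (Or.inl ⟨M, h, hp⟩)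
    · exact Or.inr (Or.inr ⟨M, h, hp⟩)
  · rintro (hp | ⟨M, h, hp⟩ | ⟨M, h, hp⟩)
    · exact ⟨N, .root, hp⟩
    · exact ⟨M, inTree_iff.2 (Or.inr (Or.inl h)), hp⟩
    · exact ⟨M, inTree_iff.2 (Or.inr (Or.inr h)), hp⟩

theorem mem_treeRegion_iff {a : ℝ} {N : Triple} {w : ℝ × ℝ} :
    w ∈ treeRegion a N ↔ w ∈ bicorn N ∨ w ∈ treeRegion a N.lam ∨ w ∈ treeRegion a (N.rho a) := by
  constructor
  · rintro ⟨M, hM, hp⟩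
    rcases inTree_iff.1 hM with rfl | h | h
    · exact Or.inl hp
    · exact Or.inr (Or.inl ⟨M, h, hp⟩)
    · exact Or.inr (Or.inr ⟨M, h, hp⟩)
  · rintro (hp | ⟨M, h, hp⟩ | ⟨M, h, hp⟩)
    · exact ⟨N, .root, hp⟩
    · exact ⟨M, inTree_iff.2 (Or.inr (Or.inl h)), hp⟩
    · exact ⟨M, inTree_iff.2 (Or.inr (Or.inr h)), hp⟩

namespace Triple.IsReduced

variable {a X Y : ℝ} {N : Triple}

theorem isApex_iff (ha : 0 < a) (hN : N.IsReduced a) {p : ℝ × ℝ} :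
    IsApex N.G N.F p ↔ p = (N.apexX a, √(N.apexSq a)) := by
  obtain ⟨hx, hy, hz⟩ := hN.isFactorization.invHeight_pos
  obtain ⟨h, hF, hG⟩ := hN.isFactorization.markov_and_centers ha
  have e1 := sq_half_sub_div hx hz h
  have e2 := sq_half_sub_div hy hz (hN.markov_symm ha)
  have g1 := half_sub_div_pos hx hy hz h hN.F_le
  have g2 := half_sub_div_pos hy hx hz (hN.markov_symm ha) hN.G_le
  set u := a / 2 - invHeight N.F / (invHeight N.G * invHeight N.E)
  set v := a / 2 - invHeight N.G / (invHeight N.F * invHeight N.E)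
  have hG' : center N.G = N.apexX a + u := by rw [hG, apexX]; ring
  have hF' : center N.F = N.apexX a - v := by rw [hF, apexX]; ring
  have hpos := hN.apexSq_pos ha
  have hτ : N.apexSq a = a ^ 2 / 4 - 1 / invHeight N.E ^ 2 := rfl
  unfold IsApex
  rw [fixedPoint_snd, fixedPoint_snd, div_pow, div_pow, one_pow]
  have hfst : ∀ A : SL2R, (fixedPoint A).1 = center A := fun _ => rfl
  rw [hfst, hfst, hG', hF']
  constructor
  · rintro ⟨hp, -, h1, h2⟩
    -- Subtracting the two circle equations leaves a linear equation for the abscissa.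
    have h3 : 2 * (u + v) * (N.apexX a - p.1) = 0 := by
      linear_combination h1 - h2 - e1 + e2
    have h4 : N.apexX a = p.1 := by
      have := (mul_eq_zero.mp h3).resolve_left (by positivity)
      linarith
    have h5 : N.apexSq a = p.2 ^ 2 := by
      rw [h4] at h1
      linear_combination h1 - e1 + hτ
    rw [h4, h5, Real.sqrt_sq hp.le]
  · rintro rfl
    refine ⟨Real.sqrt_pos.2 hpos, ?_, ?_, ?_⟩
    · intro hfp
      have := congrArg Prod.fst hfp
      rw [hfst, hfst, hG', hF'] at this
      linarith
    · rw [Real.sq_sqrt hpos.le]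
      linear_combination e1 - hτ
    · rw [Real.sq_sqrt hpos.le]
      linear_combination e2 - hτ

theorem apexSq_eq_of_isApex (ha : 0 < a) (hN : N.IsReduced a)
    (h : IsApex N.G N.F (X, Y)) : Y ^ 2 = N.apexSq a ∧ X = N.apexX a := by
  rw [hN.isApex_iff ha, Prod.mk.injEq] at h
  rw [h.2, Real.sq_sqrt (hN.apexSq_pos ha).le]
  exact ⟨rfl, h.1⟩

theorem isApex_of_apexSq_eq (ha : 0 < a) (hN : N.IsReduced a) (hY : 0 < Y)
    (h : Y ^ 2 = N.apexSq a) : IsApex N.G N.F (N.apexX a, Y) := by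
  rw [hN.isApex_iff ha, ← h, Real.sqrt_sq hY.le]

theorem apexSq_le_of_inTree (ha : 0 < a) (hN : N.IsReduced a) {M : Triple}
    (hM : InTree a N M) : N.apexSq a ≤ M.apexSq a := by
  have hz := hN.isFactorization.invHeight_pos.2.2
  have := hN.invHeight_le_of_inTree ha hM
  have : 1 / invHeight M.E ^ 2 ≤ 1 / invHeight N.E ^ 2 := by gcongr
  unfold apexSq
  linarith

theorem apexSq_le_of_mem_apexes (ha : 0 < a) (hN : N.IsReduced a)
    (h : (X, Y) ∈ apexes a N) : N.apexSq a ≤ Y ^ 2 := by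
  obtain ⟨M, hM, hp⟩ := h
  rw [((hN.of_inTree ha hM).apexSq_eq_of_isApex ha hp).1]
  exact hN.apexSq_le_of_inTree ha hM

theorem apexSq_lt_of_mem_treePunctures (ha : 0 < a) (hN : N.IsReduced a)
    (h : (X, Y) ∈ treePunctures a N) : N.apexSq a < Y ^ 2 := by
  rw [treePunctures_eq] at h
  rcases h with h | h
  · exact (hN.apexSq_lt_lam ha).trans_le ((hN.lam ha).apexSq_le_of_mem_apexes ha h)
  · exact (hN.apexSq_lt_rho ha).trans_le ((hN.rho ha).apexSq_le_of_mem_apexes ha h)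

end Triple.IsReduced

/-! ### Slices below the first bifurcation -/

theorem mem_bicorn_iff {N : Triple} {X Y : ℝ} (hY : 0 < Y)
    (hy : 1 / invHeight N.F ^ 2 ≤ Y ^ 2) :
    (X, Y) ∈ bicorn N ↔ (leftOuter N.G Y < X ∧ X < leftInner N.G Y) ∨
      (rightInner N.F Y < X ∧ X < rightOuter N.F Y) := by
  rw [bicorn, mem_union, mem_upliftMinus_iff hY, mem_upliftPlus_iff hY hy]

/-- A reduced triple with `x² + y² ≤ z²` whose puncture is not below the height `Y`, while the
fixed points of `F` and `G` are not above it. -/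
structure Triple.IsShadowed (a Y : ℝ) (N : Triple) : Prop where
  isReduced : N.IsReduced a
  sq_add_sq_le : invHeight N.G ^ 2 + invHeight N.F ^ 2 ≤ invHeight N.E ^ 2
  le_apexSq : Y ^ 2 ≤ N.apexSq a
  G_le : 1 / invHeight N.G ^ 2 ≤ Y ^ 2
  F_le : 1 / invHeight N.F ^ 2 ≤ Y ^ 2

namespace Triple.IsShadowed

variable {a X Y : ℝ} {N : Triple}

theorem E_le (ha : 0 < a) (hN : N.IsShadowed a Y) : 1 / invHeight N.E ^ 2 ≤ Y ^ 2 :=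
  (hN.isReduced.one_div_le_apexSq ha).2.2.1.trans hN.G_le

theorem lam (ha : 0 < a) (hN : N.IsShadowed a Y) : N.lam.IsShadowed a Y :=
  ⟨hN.isReduced.lam ha, hN.isReduced.sq_add_sq_le_lam ha,
    hN.le_apexSq.trans (hN.isReduced.apexSq_lt_lam ha).le, hN.G_le, hN.E_le ha⟩

theorem rho (ha : 0 < a) (hN : N.IsShadowed a Y) : (N.rho a).IsShadowed a Y :=
  ⟨hN.isReduced.rho ha, hN.isReduced.sq_add_sq_le_rho ha,
    hN.le_apexSq.trans (hN.isReduced.apexSq_lt_rho ha).le,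
    by rw [rho_G, invHeight_shift]; exact hN.E_le ha, hN.F_le⟩

/-- The new piece U₊(E) is swallowed by U₋(G) at or above the height where Y² = a²/4 - 1/x², that of
ap(FE), and by U₊(F) at or below it. -/
theorem mem_bicorn_of_lam (ha : 0 < a) (hY : 0 < Y) (hN : N.IsShadowed a Y)
    (h : (X, Y) ∈ bicorn N.lam) : (X, Y) ∈ bicorn N := by
  rw [mem_bicorn_iff hY hN.F_le]
  rw [mem_bicorn_iff hY (hN.lam ha).F_le, lam_G, lam_F] at h
  rcases h with h | ⟨h1, h2⟩
  · exact Or.inl h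
  rcases le_total (a ^ 2 / 4 - 1 / invHeight N.G ^ 2) (Y ^ 2) with hx | hx
  · left
    exact ⟨(hN.isReduced.leftOuter_le_rightInner ha hx (hN.E_le ha)).trans_lt h1,
      h2.trans_le ((hN.isReduced.outer_of_le_apexSq ha hN.le_apexSq).1.trans
        (hN.isReduced.inner_of_le_apexSq ha hN.le_apexSq).1)⟩
  · right
    exact ⟨(hN.isReduced.rightInner_F_le_E ha hN.sq_add_sq_le hx hN.F_le).trans_lt h1,
      h2.trans_le (hN.isReduced.outer_le_outer ha Y).1⟩

theorem mem_bicorn_of_rho (ha : 0 < a) (hY : 0 < Y) (hN : N.IsShadowed a Y)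
    (h : (X, Y) ∈ bicorn (N.rho a)) : (X, Y) ∈ bicorn N := by
  rw [mem_bicorn_iff hY hN.F_le]
  rw [mem_bicorn_iff hY (hN.rho ha).F_le, rho_G, rho_F] at h
  rcases h with ⟨h1, h2⟩ | h
  swap
  · exact Or.inr h
  rcases le_total (a ^ 2 / 4 - 1 / invHeight N.F ^ 2) (Y ^ 2) with hy | hy
  · right
    exact ⟨((hN.isReduced.inner_of_le_apexSq ha hN.le_apexSq).2.trans
        (hN.isReduced.outer_of_le_apexSq ha hN.le_apexSq).2).trans_lt h1,
      h2.trans_le (hN.isReduced.leftInner_shift_le_rightOuter ha hy (hN.E_le ha))⟩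
  · left
    exact ⟨(hN.isReduced.outer_le_outer ha Y).2.trans_lt h1,
      h2.trans_le (hN.isReduced.leftInner_shift_le_G ha hN.sq_add_sq_le hy hN.G_le)⟩

theorem mem_treeRegion_iff (ha : 0 < a) (hY : 0 < Y) (hN : N.IsShadowed a Y) :
    (X, Y) ∈ treeRegion a N ↔ (X, Y) ∈ bicorn N := by
  refine ⟨?_, fun h => ⟨N, .root, h⟩⟩
  rintro ⟨M, hM, h⟩
  have key : M.IsShadowed a Y ∧ ((X, Y) ∈ bicorn M → (X, Y) ∈ bicorn N) := by
    clear h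
    induction hM with
    | root => exact ⟨hN, id⟩
    | lam M _ ih => exact ⟨ih.1.lam ha, fun h => ih.2 (ih.1.mem_bicorn_of_lam ha hY h)⟩
    | rho M _ ih => exact ⟨ih.1.rho ha, fun h => ih.2 (ih.1.mem_bicorn_of_rho ha hY h)⟩
  exact key.2 h

end Triple.IsShadowed

/-! ### Slices of the tree region -/

/-- At height `Y` the tree region of `N` is the open interval between the outer boundary curves,
without the apexes, and these lie between the inner boundary curves. -/
def SliceFills (a Y : ℝ) (N : Triple) : Prop :=
  ∀ X, ((X, Y) ∈ treeRegion a N ↔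
      (leftOuter N.G Y < X ∧ X < rightOuter N.F Y) ∧ (X, Y) ∉ apexes a N) ∧
    ((X, Y) ∈ apexes a N → leftInner N.G Y ≤ X ∧ X ≤ rightInner N.F Y)

namespace Triple

variable {a X Y : ℝ} {N : Triple}

theorem IsShadowed.sliceFills (ha : 0 < a) (hY : 0 < Y) (hN : N.IsShadowed a Y)
    (hL : leftOuter N.G Y ≤ rightInner N.F Y) (hR : leftInner N.G Y ≤ rightOuter N.F Y) :
    SliceFills a Y N := by
  intro X
  have hred := hN.isReduced
  have hGo := leftOuter_lt_leftInner hred.isFactorization.orderTwo_G hY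
  have hFo := rightInner_lt_rightOuter hred.isFactorization.orderTwo_F hY
  rw [hN.mem_treeRegion_iff ha hY, mem_bicorn_iff hY hN.F_le]
  -- Below the puncture the two pieces overlap. At its height they abut at the apex, the only one on
  -- this slice because those of proper descendants are strictly higher.
  rcases hN.le_apexSq.lt_or_eq with hlt | heq
  · obtain ⟨h1, h2⟩ := hred.inner_of_lt_apexSq ha hlt
    have hno : (X, Y) ∉ apexes a N := fun h => by
      have := hred.apexSq_le_of_mem_apexes ha h
      linarith
    refine ⟨⟨?_, ?_⟩, fun h => absurd h hno⟩
    · rintro (⟨h3, h4⟩ | ⟨h3, h4⟩)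
      · exact ⟨⟨h3, h4.trans_le hR⟩, hno⟩
      · exact ⟨⟨hL.trans_lt h3, h4⟩, hno⟩
    · rintro ⟨⟨h3, h4⟩, -⟩
      rcases lt_or_ge X (leftInner N.G Y) with h5 | h5
      · exact Or.inl ⟨h3, h5⟩
      · exact Or.inr ⟨by linarith, h4⟩
  · obtain ⟨h1, h2⟩ := hred.inner_of_apexSq_le ha heq.ge
    obtain ⟨h1', h2'⟩ := hred.inner_of_le_apexSq ha heq.le
    have hap : (X, Y) ∈ apexes a N ↔ X = N.apexX a := by
      constructor
      · intro h
        rcases mem_apexes_iff.1 h with h | h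
        · exact (hred.apexSq_eq_of_isApex ha h).2
        · have := hred.apexSq_lt_of_mem_treePunctures ha h
          linarith
      · rintro rfl
        exact mem_apexes_iff.2 (Or.inl (hred.isApex_of_apexSq_eq ha hY heq))
    rw [hap]
    refine ⟨⟨?_, ?_⟩, ?_⟩
    · rintro (⟨h3, h4⟩ | ⟨h3, h4⟩)
      · exact ⟨⟨h3, h4.trans_le hR⟩, by linarith⟩
      · exact ⟨⟨hL.trans_lt h3, h4⟩, by linarith⟩
    · rintro ⟨⟨h3, h4⟩, h5⟩
      rcases lt_or_gt_of_ne h5 with h5 | h5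
      · exact Or.inl ⟨h3, by linarith⟩
      · exact Or.inr ⟨by linarith, h4⟩
    · rintro rfl
      exact ⟨h1, h2⟩

theorem IsReduced.apexSq_ge_outer (ha : 0 < a) (hN : N.IsReduced a) :
    a ^ 2 / 4 - 1 / invHeight N.G ^ 2 ≤ N.apexSq a ∧
      a ^ 2 / 4 - 1 / invHeight N.F ^ 2 ≤ N.apexSq a := by
  obtain ⟨-, -, h3, h4⟩ := hN.one_div_le_apexSq ha
  unfold apexSq
  constructor <;> linarith

/-- The order of the curves at a height between the puncture of `N` and `a / 2`. -/
theorem IsReduced.order (ha : 0 < a) (hN : N.IsReduced a) (hY : 0 < Y) (hYa : Y < a / 2)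
    (h : N.apexSq a ≤ Y ^ 2) :
    leftOuter N.G Y ≤ rightInner N.E Y ∧ leftInner (shift a N.E) Y ≤ rightOuter N.F Y ∧
    rightInner N.E Y ≤ leftOuter (shift a N.E) Y ∧
    rightOuter N.E Y ≤ leftInner (shift a N.E) Y ∧
    rightInner N.E Y < N.apexX a ∧ N.apexX a < leftInner (shift a N.E) Y := by
  obtain ⟨h1, h2⟩ := hN.apexSq_ge_outer ha
  obtain ⟨-, -, hz⟩ := hN.one_div_le_of_apexSq_le ha h
  have hYa' : Y ^ 2 < a ^ 2 / 4 := by nlinarith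
  obtain ⟨h3, h4⟩ := hN.rightInner_le_leftOuter_shift ha hz hYa'.le
  obtain ⟨h5, h6⟩ := hN.rightInner_lt_apexX ha hYa'
  exact ⟨hN.leftOuter_le_rightInner ha (h1.trans h) hz,
    hN.leftInner_shift_le_rightOuter ha (h2.trans h) hz, h3, h4, h5, h6⟩

/-- The slices of the children overlap because the outer curves of E and of its translate have
crossed. The punctures of λ(N) lie between the inner curves of G and E, hence outside the bicorn of
N and outside the slice of ρ(N), and symmetrically; this is why `SliceFills` records the
confinement. -/
theorem IsReduced.slice_of_children (ha : 0 < a) (hN : N.IsReduced a) (hY : 0 < Y)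
    (hYa : Y < a / 2) (h : N.apexSq a < Y ^ 2) (hlam : SliceFills a Y N.lam)
    (hrho : SliceFills a Y (N.rho a)) (X : ℝ) :
    ((X, Y) ∈ treeRegion a N ↔
      (leftOuter N.G Y < X ∧ X < rightOuter N.F Y) ∧ (X, Y) ∉ treePunctures a N) ∧
    ((X, Y) ∈ treePunctures a N → leftInner N.G Y ≤ X ∧ X ≤ rightInner N.F Y) := by
  obtain ⟨h1, h2, h3, h4, h5, h6⟩ := hN.order ha hY hYa h.le
  obtain ⟨h7, h8⟩ := hN.inner_of_apexSq_lt ha h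
  obtain ⟨h9, h10⟩ := hN.outer_of_apexSq_lt h
  have hGo := leftOuter_lt_leftInner hN.isFactorization.orderTwo_G hY
  have hFo := rightInner_lt_rightOuter hN.isFactorization.orderTwo_F hY
  obtain ⟨l1, l2⟩ := hlam X
  obtain ⟨r1, r2⟩ := hrho X
  rw [lam_G, lam_F] at l1 l2
  rw [rho_G, rho_F] at r1 r2
  rw [treePunctures_eq, mem_union, mem_treeRegion_iff, l1, r1,
    mem_bicorn_iff hY (hN.one_div_le_of_apexSq_le ha h.le).2.1]
  refine ⟨⟨?_, ?_⟩, ?_⟩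
  · rintro ((⟨k1, k2⟩ | ⟨k1, k2⟩) | ⟨⟨k1, k2⟩, k3⟩ | ⟨⟨k1, k2⟩, k3⟩)
    · refine ⟨⟨k1, by linarith⟩, ?_⟩
      rintro (k | k)
      · linarith [(l2 k).1]
      · linarith [(r2 k).1]
    · refine ⟨⟨by linarith, k2⟩, ?_⟩
      rintro (k | k)
      · linarith [(l2 k).2]
      · linarith [(r2 k).2]
    · refine ⟨⟨k1, by linarith⟩, ?_⟩
      rintro (k | k)
      · exact k3 k
      · linarith [(r2 k).1]
    · refine ⟨⟨by linarith, k2⟩, ?_⟩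
      rintro (k | k)
      · linarith [(l2 k).2]
      · exact k3 k
  · rintro ⟨⟨k1, k2⟩, k3⟩
    rw [not_or] at k3
    rcases lt_or_ge X (rightOuter N.E Y) with k | k
    · exact Or.inr (Or.inl ⟨⟨k1, k⟩, k3.1⟩)
    · exact Or.inr (Or.inr ⟨⟨by linarith, k2⟩, k3.2⟩)
  · rintro (k | k)
    · have := l2 k
      constructor <;> linarith
    · have := r2 k
      constructor <;> linarith

/-- A growth rate `κ > 1` of the first entry along the whole tree of `N`. -/
structure HasGrowth (a κ : ℝ) (N : Triple) : Prop where
  isReduced : N.IsReduced a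
  G_ge : κ ≤ a * invHeight N.G - 1
  F_ge : κ ≤ a * invHeight N.F - 1

/-- Since y ≤ z, axz - y ≥ (ax - 1)z. The rate persists because x is kept and y is replaced by z ≥
y. -/
theorem HasGrowth.lam (ha : 0 < a) {κ : ℝ} (hN : N.HasGrowth a κ) :
    N.lam.HasGrowth a κ ∧ κ * invHeight N.E ≤ invHeight N.lam.E := by
  obtain ⟨hx, hy, hz⟩ := hN.isReduced.isFactorization.invHeight_pos
  have := hN.isReduced.F_le
  have := hN.G_ge
  refine ⟨⟨hN.isReduced.lam ha, hN.G_ge, hN.F_ge.trans ?_⟩, ?_⟩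
  · rw [lam_F]; gcongr
  · rw [hN.isReduced.isFactorization.invHeight_lam ha]
    nlinarith

theorem HasGrowth.rho (ha : 0 < a) {κ : ℝ} (hN : N.HasGrowth a κ) :
    (N.rho a).HasGrowth a κ ∧ κ * invHeight N.E ≤ invHeight (N.rho a).E := by
  obtain ⟨hx, hy, hz⟩ := hN.isReduced.isFactorization.invHeight_pos
  have := hN.isReduced.G_le
  have := hN.F_ge
  refine ⟨⟨hN.isReduced.rho ha, hN.G_ge.trans ?_, hN.F_ge⟩, ?_⟩
  · rw [rho_G, invHeight_shift]; gcongr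
  · rw [hN.isReduced.isFactorization.invHeight_rho ha]
    nlinarith

/-- From 2yz ≤ y² + z² < axyz one gets ax > 2, and likewise ay > 2. -/
theorem IsReduced.exists_hasGrowth (ha : 0 < a) (hN : N.IsReduced a) :
    ∃ κ, 1 < κ ∧ N.HasGrowth a κ := by
  obtain ⟨hx, hy, hz⟩ := hN.isFactorization.invHeight_pos
  have h := (hN.isFactorization.markov_and_centers ha).1
  set x := invHeight N.G
  set y := invHeight N.F
  set z := invHeight N.E
  have h1 : 2 < a * x := by
    have : 2 * (y * z) < a * x * (y * z) := by nlinarith [sq_nonneg (y - z)]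
    exact lt_of_mul_lt_mul_right this (by positivity)
  have h2 : 2 < a * y := by
    have : 2 * (x * z) < a * y * (x * z) := by nlinarith [sq_nonneg (x - z)]
    exact lt_of_mul_lt_mul_right this (by positivity)
  exact ⟨min (a * x - 1) (a * y - 1), lt_min (by linarith) (by linarith), hN,
    min_le_left _ _, min_le_right _ _⟩

theorem IsReduced.exists_pow_bound (hN : N.IsReduced a) {κ b : ℝ} (hκ : 1 < κ) (hb : b < a ^ 2 / 4) :
    ∃ n : ℕ, b < a ^ 2 / 4 - 1 / (κ ^ n * invHeight N.E) ^ 2 := by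
  have hz := hN.isFactorization.invHeight_pos.2.2
  set z := invHeight N.E
  have hδ : 0 < a ^ 2 / 4 - b := by linarith
  obtain ⟨n, hn⟩ := pow_unbounded_of_one_lt (1 / (z ^ 2 * (a ^ 2 / 4 - b))) hκ
  refine ⟨n, ?_⟩
  have h1 : 1 ≤ κ ^ n := one_le_pow₀ hκ.le
  have h2 : 1 / (κ ^ n * z) ^ 2 < a ^ 2 / 4 - b := by
    rw [div_lt_iff₀ (by positivity)] at hn ⊢
    have : κ ^ n * (z ^ 2 * (a ^ 2 / 4 - b)) ≤ κ ^ n * (κ ^ n * (z ^ 2 * (a ^ 2 / 4 - b))) :=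
      le_mul_of_one_le_left (by positivity) h1
    linarith [this, show (a ^ 2 / 4 - b) * (κ ^ n * z) ^ 2 =
      κ ^ n * (κ ^ n * (z ^ 2 * (a ^ 2 / 4 - b))) by ring]
  linarith

theorem lt_sub_one_div_sq_of_growth {κ b z z' : ℝ} (hκ : 1 < κ) (hz : 0 < z) (hz' : κ * z ≤ z') {n : ℕ}
    (hb : b < a ^ 2 / 4 - 1 / (κ ^ (n + 1) * z) ^ 2) :
    b < a ^ 2 / 4 - 1 / (κ ^ n * z') ^ 2 := by
  have hκ0 : 0 < κ := by linarith
  have h1 : κ ^ (n + 1) * z ≤ κ ^ n * z' := by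
    rw [pow_succ, mul_assoc]
    gcongr
  have h2 : 1 / (κ ^ n * z') ^ 2 ≤ 1 / (κ ^ (n + 1) * z) ^ 2 := by gcongr
  linarith

/-- Induction on the number n of moves after which growth must have lifted the puncture above Y. The
two inequalities between curves keep the bicorn inside the outer interval; for the children they
follow from the order of the curves of N. -/
theorem HasGrowth.sliceFills (ha : 0 < a) {κ : ℝ} (hκ : 1 < κ) (hY : 0 < Y) (hYa : Y < a / 2)
    (n : ℕ) : ∀ N : Triple, N.HasGrowth a κ →
      invHeight N.G ^ 2 + invHeight N.F ^ 2 ≤ invHeight N.E ^ 2 →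
      1 / invHeight N.G ^ 2 ≤ Y ^ 2 → 1 / invHeight N.F ^ 2 ≤ Y ^ 2 →
      leftOuter N.G Y ≤ rightInner N.F Y → leftInner N.G Y ≤ rightOuter N.F Y →
      Y ^ 2 < a ^ 2 / 4 - 1 / (κ ^ n * invHeight N.E) ^ 2 → SliceFills a Y N := by
  induction n with
  | zero =>
    intro N hN h2 hG hF hL hR hb
    rw [pow_zero, one_mul] at hb
    exact IsShadowed.sliceFills ha hY ⟨hN.isReduced, h2, hb.le, hG, hF⟩ hL hR
  | succ n ih =>
    intro N hN h2 hG hF hL hR hb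
    rcases le_or_gt (Y ^ 2) (N.apexSq a) with hle | hlt
    · exact IsShadowed.sliceFills ha hY ⟨hN.isReduced, h2, hle, hG, hF⟩ hL hR
    have hred := hN.isReduced
    have hz := hred.isFactorization.invHeight_pos.2.2
    have hE := (hred.one_div_le_of_apexSq_le ha hlt.le).2.2
    obtain ⟨h1, h2, h3, h4, h5, h6⟩ := hred.order ha hY hYa hlt.le
    obtain ⟨h7, h8⟩ := hred.inner_of_apexSq_lt ha hlt
    obtain ⟨h9, h10⟩ := hred.outer_of_apexSq_lt hlt
    have hlam := ih N.lam (hN.lam ha).1 (hred.sq_add_sq_le_lam ha) hG hE h1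
      (h7.trans h9).le (lt_sub_one_div_sq_of_growth hκ hz (hN.lam ha).2 hb)
    have hrho := ih (N.rho a) (hN.rho ha).1 (hred.sq_add_sq_le_rho ha)
      (by rw [rho_G, invHeight_shift]; exact hE) hF
      (h10.trans h8).le h2 (lt_sub_one_div_sq_of_growth hκ hz (hN.rho ha).2 hb)
    intro X
    have hne : ¬ IsApex N.G N.F (X, Y) := fun h => by
      linarith [(hred.apexSq_eq_of_isApex ha h).1]
    have hap : (X, Y) ∈ apexes a N ↔ (X, Y) ∈ treePunctures a N := by
      rw [mem_apexes_iff]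
      exact or_iff_right hne
    rw [hap]
    exact hred.slice_of_children ha hY hYa hlt hlam hrho X

/-- The slices of the tree region of a reduced triple above its puncture. -/
theorem IsReduced.slice (ha : 0 < a) (hN : N.IsReduced a) (hY : 0 < Y)
    (hYa : Y < a / 2) (h : N.apexSq a < Y ^ 2) (X : ℝ) :
    ((X, Y) ∈ treeRegion a N ↔
      (leftOuter N.G Y < X ∧ X < rightOuter N.F Y) ∧ (X, Y) ∉ treePunctures a N) ∧
    ((X, Y) ∈ treePunctures a N → leftInner N.G Y ≤ X ∧ X ≤ rightInner N.F Y) := by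
  obtain ⟨κ, hκ, hgr⟩ := hN.exists_hasGrowth ha
  have hYa' : Y ^ 2 < a ^ 2 / 4 := by nlinarith
  obtain ⟨hG, hF, hE⟩ := hN.one_div_le_of_apexSq_le ha h.le
  obtain ⟨h1, h2, h3, h4, h5, h6⟩ := hN.order ha hY hYa h.le
  obtain ⟨h7, h8⟩ := hN.inner_of_apexSq_lt ha h
  obtain ⟨h9, h10⟩ := hN.outer_of_apexSq_lt h
  obtain ⟨n, hn⟩ := (hN.lam ha).exists_pow_bound hκ hYa'
  obtain ⟨m, hm⟩ := (hN.rho ha).exists_pow_bound hκ hYa'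
  -- N itself need not satisfy x² + y² ≤ z², so only its children enter the induction.
  exact hN.slice_of_children ha hY hYa h
    (HasGrowth.sliceFills ha hκ hY hYa n _ (hgr.lam ha).1 (hN.sq_add_sq_le_lam ha) hG hE h1
      (h7.trans h9).le hn)
    (HasGrowth.sliceFills ha hκ hY hYa m _ (hgr.rho ha).1 (hN.sq_add_sq_le_rho ha)
      (by rw [rho_G, invHeight_shift]; exact hE) hF (h10.trans h8).le h2 hm) X

/-! ### Finiteness below a given height -/

theorem HasGrowth.finite (ha : 0 < a) {κ b : ℝ} (hκ : 1 < κ) (n : ℕ) :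
    ∀ N : Triple, N.HasGrowth a κ → b < a ^ 2 / 4 - 1 / (κ ^ n * invHeight N.E) ^ 2 →
      {M | InTree a N M ∧ M.apexSq a ≤ b}.Finite := by
  induction n with
  | zero =>
    intro N hN hb
    rw [pow_zero, one_mul] at hb
    convert Set.finite_empty
    ext M
    simp only [mem_ofPred_eq, mem_empty_iff_false, iff_false, not_and, not_le]
    intro hM
    exact lt_of_lt_of_le hb (hN.isReduced.apexSq_le_of_inTree ha hM)
  | succ n ih =>
    intro N hN hb
    have hz := hN.isReduced.isFactorization.invHeight_pos.2.2
    have h1 := ih N.lam (hN.lam ha).1 (lt_sub_one_div_sq_of_growth hκ hz (hN.lam ha).2 hb)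
    have h2 := ih (N.rho a) (hN.rho ha).1 (lt_sub_one_div_sq_of_growth hκ hz (hN.rho ha).2 hb)
    refine (((Set.finite_singleton N).union h1).union h2).subset ?_
    rintro M ⟨hM, hMb⟩
    rcases inTree_iff.1 hM with rfl | h | h
    · exact Or.inl (Or.inl rfl)
    · exact Or.inl (Or.inr ⟨h, hMb⟩)
    · exact Or.inr ⟨h, hMb⟩

theorem IsReduced.finite (ha : 0 < a) (hN : N.IsReduced a) {b : ℝ} (hb : b < a ^ 2 / 4) :
    {M | InTree a N M ∧ M.apexSq a ≤ b}.Finite := by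
  obtain ⟨κ, hκ, hgr⟩ := hN.exists_hasGrowth ha
  obtain ⟨n, hn⟩ := hN.exists_pow_bound hκ hb
  exact HasGrowth.finite ha hκ n N hgr hn

end Triple

/-! ### The once-punctured tridents -/

namespace Triple.IsReduced

variable {a : ℝ} {N : Triple}

theorem inner_eq_apexX (ha : 0 < a) (hN : N.IsReduced a) :
    leftInner N.G (√(N.apexSq a)) = N.apexX a ∧ rightInner N.F (√(N.apexSq a)) = N.apexX a := by
  have h := Real.sq_sqrt (hN.apexSq_pos ha).le
  obtain ⟨h1, h2⟩ := hN.inner_of_apexSq_le ha h.ge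
  obtain ⟨h3, h4⟩ := hN.inner_of_le_apexSq ha h.le
  exact ⟨le_antisymm h1 h3, le_antisymm h4 h2⟩

theorem sqrt_apexSq_lt_half (ha : 0 < a) (hN : N.IsReduced a) : √(N.apexSq a) < a / 2 := by
  rw [Real.sqrt_lt' (by linarith)]
  linarith [hN.apexSq_lt]

theorem mem_step_iff (ha : 0 < a) (hN : N.IsReduced a) {X Y : ℝ} (hY : 0 < Y)
    (h : N.apexSq a ≤ Y ^ 2) :
    (X, Y) ∈ bicorn N ∪ bicorn N.lam ∪ bicorn (N.rho a) ↔
      (leftOuter N.G Y < X ∧ X < leftInner N.G Y) ∨ (rightInner N.F Y < X ∧ X < rightOuter N.F Y) ∨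
      (rightInner N.E Y < X ∧ X < rightOuter N.E Y) ∨
      (leftOuter (shift a N.E) Y < X ∧ X < leftInner (shift a N.E) Y) := by
  obtain ⟨hG, hF, hE⟩ := hN.one_div_le_of_apexSq_le ha h
  rw [mem_union, mem_union, mem_bicorn_iff hY hF, mem_bicorn_iff hY (by exact hE),
    mem_bicorn_iff hY (by exact hF), lam_G, lam_F, rho_G, rho_F]
  tauto

theorem isOncePuncturedTrident (ha : 0 < a) (hN : N.IsReduced a) :
    IsOncePuncturedTrident (stepRegion a N) (lowerHeight a (invHeight N.E)) (a / 2)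
      (N.apexX a, √(N.apexSq a)) (N.lam.apexX a, √(N.lam.apexSq a))
      ((N.rho a).apexX a, √((N.rho a).apexSq a)) := by
  have hh : lowerHeight a (invHeight N.E) = √(N.apexSq a) := rfl
  have hlam := hN.lam ha
  have hrho := hN.rho ha
  have hpos := hN.apexSq_pos ha
  have hpos' := Real.sqrt_pos.2 hpos
  have hl : √(N.apexSq a) < √(N.lam.apexSq a) := Real.sqrt_lt_sqrt hpos.le (hN.apexSq_lt_lam ha)
  have hr : √(N.apexSq a) < √((N.rho a).apexSq a) :=
    Real.sqrt_lt_sqrt hpos.le (hN.apexSq_lt_rho ha)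
  have sq_le : ∀ {M : Triple} {Y : ℝ}, √(M.apexSq a) ≤ Y → M.apexSq a ≤ Y ^ 2 :=
    fun h => (Real.sqrt_le_iff.1 h).2
  have outer : ∀ {Y}, 0 < Y → leftOuter N.G Y < leftInner N.G Y ∧
      rightInner N.F Y < rightOuter N.F Y := fun hY =>
    ⟨leftOuter_lt_leftInner hN.isFactorization.orderTwo_G hY,
      rightInner_lt_rightOuter hN.isFactorization.orderTwo_F hY⟩
  rw [hh]
  -- The left notch is the gap in the bicorn of λ(N) above its own puncture, between U₋(G) and
  -- U₊(E); the right one is the gap in the bicorn of ρ(N).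
  refine ⟨leftOuter N.G, leftInner N.G, rightInner N.E, leftInner (shift a N.E), rightInner N.F,
    rightOuter N.F, (continuous_leftOuter _).continuousOn, (continuous_rightOuter _).continuousOn,
    (continuous_leftInner _).continuousOn, (continuous_rightInner _).continuousOn,
    (continuous_leftInner _).continuousOn, (continuous_rightInner _).continuousOn,
    hl, hlam.sqrt_apexSq_lt_half ha, hr, hrho.sqrt_apexSq_lt_half ha, ?_,
    ⟨(hlam.inner_eq_apexX ha).1, (hlam.inner_eq_apexX ha).2, ?_⟩,
    ⟨(hrho.inner_eq_apexX ha).1, (hrho.inner_eq_apexX ha).2, ?_⟩, ?_, ?_, ?_,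
    ⟨le_rfl, hl, hr, ?_⟩, ?_⟩
  · rintro Y ⟨h1, h2⟩
    have hY : 0 < Y := hpos'.trans_le h1
    obtain ⟨k1, k2, k3, k4, k5, k6⟩ := hN.order ha hY h2 (sq_le h1)
    linarith
  · rintro Y ⟨h1, h2⟩
    have hY : 0 < Y := (Real.sqrt_nonneg _).trans_lt h1
    obtain ⟨k1, k2⟩ := hlam.inner_of_apexSq_lt ha ((Real.sqrt_lt' hY).1 h1)
    exact k1.trans k2
  · rintro Y ⟨h1, h2⟩
    have hY : 0 < Y := (Real.sqrt_nonneg _).trans_lt h1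
    obtain ⟨k1, k2⟩ := hrho.inner_of_apexSq_lt ha ((Real.sqrt_lt' hY).1 h1)
    exact k1.trans k2
  · rintro Y ⟨h1, h2⟩
    have h1' : √(N.apexSq a) ≤ Y := hl.le.trans h1
    have hY : 0 < Y := hpos'.trans_le h1'
    obtain ⟨k1, k2, k3, k4, k5, k6⟩ := hN.order ha hY h2 (sq_le h1')
    exact ⟨(outer hY).1, by linarith⟩
  · rintro Y ⟨h1, h2⟩
    have h1' : √(N.apexSq a) ≤ Y := hr.le.trans h1
    have hY : 0 < Y := hpos'.trans_le h1'
    obtain ⟨k1, k2, k3, k4, k5, k6⟩ := hN.order ha hY h2 (sq_le h1')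
    exact ⟨by linarith, (outer hY).2⟩
  · rintro Y ⟨⟨h1, h2⟩, -⟩
    have h1' : √(N.apexSq a) ≤ Y := hl.le.trans h1
    have hY : 0 < Y := hpos'.trans_le h1'
    obtain ⟨k1, k2, k3, k4, k5, k6⟩ := hN.order ha hY h2 (sq_le h1')
    linarith
  · obtain ⟨k1, k2⟩ := outer hpos'
    rw [(hN.inner_eq_apexX ha).1] at k1
    rw [(hN.inner_eq_apexX ha).2] at k2
    exact ⟨k1, k2⟩
  · ext ⟨X, Y⟩
    simp only [stepRegion, mem_inter_iff, mem_ofPred_eq, Set.mem_sdiff, mem_singleton_iff,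
      Prod.mk.injEq]
    rw [hh]
    by_cases h1 : √(N.apexSq a) ≤ Y
    swap
    · simp [h1]
    by_cases h2 : Y < a / 2
    swap
    · simp [h2]
    have hY : 0 < Y := hpos'.trans_le h1
    have hτ := sq_le h1
    obtain ⟨k1, k2, k3, k4, k5, k6⟩ := hN.order ha hY h2 hτ
    obtain ⟨k7, k8⟩ := hN.inner_of_apexSq_le ha hτ
    obtain ⟨o1, o2⟩ := outer hY
    have o3 := rightInner_lt_rightOuter hN.isFactorization.orderTwo_E hY
    have o4 := leftOuter_lt_leftInner (hN.isFactorization.orderTwo_E.shift a) hY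
    have below₁ : √(N.lam.apexSq a) ≤ Y ∨ rightInner N.E Y < leftInner N.G Y := by
      rcases le_or_gt (√(N.lam.apexSq a)) Y with h | h
      · exact Or.inl h
      · obtain ⟨m1, m2⟩ := hlam.inner_of_lt_apexSq ha ((Real.lt_sqrt hY.le).1 h)
        exact Or.inr (m2.trans m1)
    have below₂ : √((N.rho a).apexSq a) ≤ Y ∨ rightInner N.F Y < leftInner (shift a N.E) Y := by
      rcases le_or_gt (√((N.rho a).apexSq a)) Y with h | h
      · exact Or.inl h
      · obtain ⟨m1, m2⟩ := hrho.inner_of_lt_apexSq ha ((Real.lt_sqrt hY.le).1 h)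
        exact Or.inr (m2.trans m1)
    rw [hN.mem_step_iff ha hY hτ]
    simp only [h1, h2, true_and]
    -- Above the puncture the two middle pieces overlap; at its height both end at `N.apexX a`.
    have hcenter : (N.apexX a < rightOuter N.E Y ∧ leftOuter (shift a N.E) Y < N.apexX a ∧
          Y ≠ √(N.apexSq a)) ∨
        (rightOuter N.E Y = N.apexX a ∧ leftOuter (shift a N.E) Y = N.apexX a ∧
          Y = √(N.apexSq a)) := by
      rcases h1.lt_or_eq with h | h
      · obtain ⟨m1, m2⟩ := hN.outer_of_apexSq_lt ((Real.sqrt_lt' hY).1 h)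
        exact Or.inl ⟨m1, m2, h.ne'⟩
      · have hs : Y ^ 2 = N.apexSq a := by rw [← h, Real.sq_sqrt hpos.le]
        obtain ⟨m1, m2⟩ := hN.outer_of_le_apexSq ha hs.le
        have m3 : a / 2 ≤ √(Y ^ 2 + 1 / invHeight N.E ^ 2) :=
          Real.le_sqrt_of_sq_le (by rw [hs]; unfold apexSq; linarith)
        refine Or.inr ⟨le_antisymm m1 ?_, le_antisymm ?_ m2, h.symm⟩
        · unfold apexX rightOuter; linarith
        · unfold apexX leftOuter
          rw [invHeight_shift, center_shift hN.isFactorization.orderTwo_E]; linarith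
    have below : Y = √(N.apexSq a) → leftInner N.G Y = N.apexX a ∧ rightInner N.F Y = N.apexX a :=
      fun h => h ▸ hN.inner_eq_apexX ha
    -- From here on only the order of these abscissae matters.
    generalize leftOuter N.G Y = L at *
    generalize leftInner N.G Y = A at *
    generalize rightInner N.E Y = S at *
    generalize rightOuter N.E Y = m₂ at *
    generalize leftOuter (shift a N.E) Y = m₁ at *
    generalize leftInner (shift a N.E) Y = S' at *
    generalize rightInner N.F Y = B at *
    generalize rightOuter N.F Y = R at *
    generalize N.apexX a = c at *
    constructor
    · intro h
      have hX : ¬(X = c ∧ Y = √(N.apexSq a)) := by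
        rintro ⟨rfl, hy⟩
        obtain ⟨b1, b2⟩ := below hy
        rcases hcenter with ⟨e1, e2, e3⟩ | ⟨e1, e2, e3⟩
        · exact e3 hy
        · rcases h with h | h | h | h <;> linarith [h.1, h.2]
      refine ⟨?_, hX⟩
      have hm : m₁ ≤ m₂ := by rcases hcenter with h | h <;> linarith [h.1, h.2.1]
      rcases h with h | h | h | h
      · exact ⟨h.1, by linarith, fun k => by linarith [k.2.1, h.2],
          fun k => by linarith [k.2.1, h.2]⟩
      · exact ⟨by linarith, h.2, fun k => by linarith [k.2.2, h.1],
          fun k => by linarith [k.2.2, h.1]⟩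
      · exact ⟨by linarith, by linarith, fun k => by linarith [k.2.2, h.1],
          fun k => by linarith [k.2.1, h.2]⟩
      · exact ⟨by linarith, by linarith, fun k => by linarith [k.2.2, h.1],
          fun k => by linarith [k.2.1, h.2]⟩
    · rintro ⟨⟨h3, h4, h5, h6⟩, h7⟩
      by_contra hcon
      simp only [not_or, not_and, not_lt] at hcon
      obtain ⟨n1, n2, n3, n4⟩ := hcon
      have hA : A ≤ X := n1 h3
      have hB : X ≤ B := by
        by_contra! hb
        linarith [n2 hb]
      have hS : S < X := by
        by_contra! hs
        rcases below₁ with h | h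
        · exact h5 ⟨h, hA, hs⟩
        · linarith
      have hS' : X < S' := by
        by_contra! hs
        rcases below₂ with h | h
        · exact h6 ⟨h, hs, hB⟩
        · linarith
      have hm2 : m₂ ≤ X := n3 hS
      have hm1 : X ≤ m₁ := by
        by_contra! hm
        linarith [n4 hm]
      rcases hcenter with ⟨e1, e2, e3⟩ | ⟨e1, e2, e3⟩
      · linarith
      · exact h7 ⟨by linarith, e3⟩

end Triple.IsReduced

/-! ### Open regions between two graphs -/

section Graphs

variable {L R : ℝ → ℝ} {h H : ℝ}

theorem isOpen_between (hL : Continuous L) (hR : Continuous R) :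
    IsOpen {w : ℝ × ℝ | (h < w.2 ∧ w.2 < H) ∧ L w.2 < w.1 ∧ w.1 < R w.2} :=
  ((isOpen_lt continuous_const continuous_snd).and
    (isOpen_lt continuous_snd continuous_const)).and
    ((isOpen_lt (hL.comp continuous_snd) continuous_fst).and
      (isOpen_lt continuous_fst (hR.comp continuous_snd)))

/-- Interpolating linearly between the two graphs exhibits the region as the continuous image of a
rectangle. -/
theorem isConnected_between (hL : Continuous L) (hR : Continuous R) (hH : h < H)
    (hLR : ∀ Y, h < Y → Y < H → L Y < R Y) :
    IsConnected {w : ℝ × ℝ | (h < w.2 ∧ w.2 < H) ∧ L w.2 < w.1 ∧ w.1 < R w.2} := by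
  have hc : IsConnected (Ioo (0 : ℝ) 1 ×ˢ Ioo h H) :=
    (isConnected_Ioo one_pos).prod (isConnected_Ioo hH)
  have hf : Continuous fun v : ℝ × ℝ => (L v.2 + v.1 * (R v.2 - L v.2), v.2) := by fun_prop
  convert hc.image _ hf.continuousOn using 1
  ext ⟨X, Y⟩
  constructor
  · rintro ⟨⟨h1, h2⟩, h3, h4⟩
    have h5 : 0 < R Y - L Y := by linarith [hLR Y h1 h2]
    dsimp only at h3 h4
    refine ⟨((X - L Y) / (R Y - L Y), Y), ⟨⟨div_pos (by linarith) h5, ?_⟩, h1, h2⟩, ?_⟩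
    · rw [div_lt_one h5]; linarith
    · simp only [Prod.mk.injEq, and_true]
      field_simp
      ring
  · rintro ⟨⟨s, Z⟩, ⟨⟨h1, h2⟩, h3, h4⟩, h5⟩
    simp only [Prod.mk.injEq] at h5
    obtain ⟨rfl, rfl⟩ := h5
    have h6 := hLR Z h3 h4
    refine ⟨⟨h3, h4⟩, ?_, ?_⟩
    · dsimp only
      nlinarith
    · dsimp only
      nlinarith

theorem frontier_between (hL : Continuous L) (hR : Continuous R)
    (hLR : ∀ Y, h < Y → Y < H → L Y < R Y) {X Y : ℝ} (h1 : h < Y) (h2 : Y < H) :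
    (X, Y) ∈ frontier {w : ℝ × ℝ | (h < w.2 ∧ w.2 < H) ∧ L w.2 < w.1 ∧ w.1 < R w.2} ↔
      X = L Y ∨ X = R Y := by
  rw [(isOpen_between hL hR).frontier_eq]
  have hlt := hLR Y h1 h2
  constructor
  · rintro ⟨hcl, hnot⟩
    have hsub : closure {w : ℝ × ℝ | (h < w.2 ∧ w.2 < H) ∧ L w.2 < w.1 ∧ w.1 < R w.2} ⊆
        {w | L w.2 ≤ w.1 ∧ w.1 ≤ R w.2} :=
      closure_minimal (fun w hw => ⟨hw.2.1.le, hw.2.2.le⟩)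
        ((isClosed_le (hL.comp continuous_snd) continuous_fst).and
          (isClosed_le continuous_fst (hR.comp continuous_snd)))
    obtain ⟨h3, h4⟩ := hsub hcl
    dsimp only at h3 h4
    by_contra! hne
    exact hnot ⟨⟨h1, h2⟩, lt_of_le_of_ne h3 hne.1.symm, lt_of_le_of_ne h4 hne.2⟩
  · intro hX
    have hseg : (fun s : ℝ => (s, Y)) '' Ioo (L Y) (R Y) ⊆
        {w : ℝ × ℝ | (h < w.2 ∧ w.2 < H) ∧ L w.2 < w.1 ∧ w.1 < R w.2} := by
      rintro _ ⟨s, hs, rfl⟩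
      exact ⟨⟨h1, h2⟩, hs.1, hs.2⟩
    have hXmem : X ∈ closure (Ioo (L Y) (R Y)) := by
      rw [closure_Ioo hlt.ne]
      rcases hX with rfl | rfl
      · exact left_mem_Icc.2 hlt.le
      · exact right_mem_Icc.2 hlt.le
    refine ⟨closure_mono hseg (image_closure_subset_closure_image (by fun_prop)
      (mem_image_of_mem _ hXmem)), ?_⟩
    rintro ⟨-, h3, h4⟩
    dsimp only at h3 h4
    rcases hX with rfl | rfl
    · exact lt_irrefl _ h3
    · exact lt_irrefl _ h4

end Graphs

/-! ### The region filled by the tree -/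

namespace Triple.IsReduced

variable {a : ℝ} {N : Triple}

theorem betweenLowerBoundaries_eq (hN : N.IsReduced a) {h H : ℝ} (hh : 0 ≤ h) :
    betweenLowerBoundaries N.G N.F h H =
      {w | (h < w.2 ∧ w.2 < H) ∧ leftOuter N.G w.2 < w.1 ∧ w.1 < rightOuter N.F w.2} := by
  ext ⟨X, Y⟩
  constructor
  · rintro ⟨⟨h1, h2⟩, ⟨U, Y₁⟩, hu, ⟨V, Y₂⟩, hv, h3, h4, h5, h6⟩
    dsimp only at h1 h2 h3 h4 h5 h6
    have hY : 0 < Y := hh.trans_lt h1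
    rw [h3] at hu
    rw [h4] at hv
    rw [mem_lowerBoundaryMinus_iff hN.isFactorization.orderTwo_G hY] at hu
    rw [mem_lowerBoundaryPlus_iff hN.isFactorization.orderTwo_F hY] at hv
    subst hu hv
    exact ⟨⟨h1, h2⟩, h5, h6⟩
  · rintro ⟨⟨h1, h2⟩, h3, h4⟩
    have hY : 0 < Y := hh.trans_lt h1
    exact ⟨⟨h1, h2⟩, (_, Y), (mem_lowerBoundaryMinus_iff hN.isFactorization.orderTwo_G hY).2 rfl,
      (_, Y), (mem_lowerBoundaryPlus_iff hN.isFactorization.orderTwo_F hY).2 rfl, rfl, rfl, h3, h4⟩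

theorem outer_lt (ha : 0 < a) (hN : N.IsReduced a) (Y : ℝ) (h1 : √(N.apexSq a) < Y)
    (h2 : Y < a / 2) : leftOuter N.G Y < rightOuter N.F Y := by
  have hY : 0 < Y := (Real.sqrt_nonneg _).trans_lt h1
  obtain ⟨k1, k2, k3, k4, k5, k6⟩ := hN.order ha hY h2 ((Real.sqrt_lt' hY).1 h1).le
  linarith

theorem apex_mem_treePunctures (ha : 0 < a) (hN : N.IsReduced a) {M : Triple}
    (hM : InTree a N.lam M) : (M.apexX a, √(M.apexSq a)) ∈ treePunctures a N :=
  ⟨M, Or.inl hM, (((hN.lam ha).of_inTree ha hM).isApex_iff ha).2 rfl⟩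

/-- Iterating λ produces punctures of strictly increasing height. -/
theorem treePunctures_infinite (ha : 0 < a) (hN : N.IsReduced a) :
    (treePunctures a N).Infinite := by
  have hlam : ∀ n : ℕ, InTree a N.lam (Triple.lam^[n] N.lam) := by
    intro n
    induction n with
    | zero => exact .root
    | succ n ih => rw [Function.iterate_succ_apply']; exact .lam _ ih
  have hred := fun n => (hN.lam ha).of_inTree ha (hlam n)
  have hmono : StrictMono fun n : ℕ => √((Triple.lam^[n] N.lam).apexSq a) := by
    apply strictMono_nat_of_lt_succ
    intro n
    rw [Function.iterate_succ_apply']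
    exact Real.sqrt_lt_sqrt ((hred n).apexSq_pos ha).le ((hred n).apexSq_lt_lam ha)
  refine Set.infinite_of_injective_forall_mem
    (f := fun n : ℕ => ((Triple.lam^[n] N.lam).apexX a, √((Triple.lam^[n] N.lam).apexSq a)))
    ?_ fun n => hN.apex_mem_treePunctures ha (hlam n)
  intro m n hmn
  exact hmono.injective (congrArg Prod.snd hmn)

/-- A half-plane Y < b with b < a/2 serves as neighbourhood: by `IsReduced.finite` only finitely
many triples have their puncture there. -/
theorem treePunctures_locally_finite (ha : 0 < a) (hN : N.IsReduced a) {w : ℝ × ℝ}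
    (hw : 0 < w.2) (hwa : w.2 < a / 2) : ∃ V ∈ 𝓝 w, (V ∩ treePunctures a N).Finite := by
  obtain ⟨b, hb1, hb2⟩ := exists_between hwa
  refine ⟨{v | v.2 < b}, (isOpen_lt (by fun_prop) (by fun_prop)).mem_nhds hb1, ?_⟩
  have hfin := hN.finite ha (b := b ^ 2) (by nlinarith)
  refine (hfin.image fun M => (M.apexX a, √(M.apexSq a))).subset ?_
  rintro ⟨X, Y⟩ ⟨hY, hp⟩
  have hp' : (X, Y) ∈ apexes a N := mem_apexes_iff.2 (Or.inr hp)
  obtain ⟨M, hM, hMp⟩ := hp'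
  have hredM := hN.of_inTree ha hM
  have hY0 : 0 < Y := hMp.1
  refine ⟨M, ⟨hM, ?_⟩, ((hredM.isApex_iff ha).1 hMp).symm⟩
  rw [← (hredM.apexSq_eq_of_isApex ha hMp).1]
  exact pow_le_pow_left₀ hY0.le (le_of_lt hY) 2

theorem lt_half_of_mem_treePunctures (ha : 0 < a) (hN : N.IsReduced a) {X Y : ℝ}
    (h : (X, Y) ∈ treePunctures a N) : 0 < Y ∧ N.apexSq a < Y ^ 2 ∧ Y < a / 2 := by
  have hlt := hN.apexSq_lt_of_mem_treePunctures ha h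
  obtain ⟨M, hM, hp⟩ := mem_apexes_iff.2 (Or.inr h)
  have hredM := hN.of_inTree ha hM
  have h1 := (hredM.apexSq_eq_of_isApex ha hp).1
  have h2 := hredM.apexSq_lt
  refine ⟨hp.1, hlt, ?_⟩
  by_contra! hc
  nlinarith

theorem isInfinitelyPuncturedDomain (ha : 0 < a) (hN : N.IsReduced a) :
    IsInfinitelyPuncturedDomain
      (treeRegion a N ∩ openStrip (lowerHeight a (invHeight N.E)) (a / 2))
      (betweenLowerBoundaries N.G N.F (lowerHeight a (invHeight N.E)) (a / 2))
      (treePunctures a N) := by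
  have hh : lowerHeight a (invHeight N.E) = √(N.apexSq a) := rfl
  rw [hh, hN.betweenLowerBoundaries_eq (Real.sqrt_nonneg _)]
  refine ⟨isOpen_between (continuous_leftOuter _) (continuous_rightOuter _),
    isConnected_between (continuous_leftOuter _) (continuous_rightOuter _)
      (hN.sqrt_apexSq_lt_half ha) (hN.outer_lt ha), ?_, hN.treePunctures_infinite ha, ?_, ?_⟩
  · rintro ⟨X, Y⟩ hp
    obtain ⟨hY, h1, h2⟩ := hN.lt_half_of_mem_treePunctures ha hp
    obtain ⟨h3, h4⟩ := (hN.slice ha hY h2 h1 X).2 hp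
    have h5 := leftOuter_lt_leftInner hN.isFactorization.orderTwo_G hY
    have h6 := rightInner_lt_rightOuter hN.isFactorization.orderTwo_F hY
    exact ⟨⟨(Real.sqrt_lt' hY).2 h1, h2⟩, h5.trans_le h3, h4.trans_lt h6⟩
  · rintro w ⟨⟨h1, h2⟩, -⟩
    exact hN.treePunctures_locally_finite ha ((Real.sqrt_nonneg _).trans_lt h1) h2
  · ext ⟨X, Y⟩
    constructor
    · rintro ⟨h, h1, h2⟩
      have hY : 0 < Y := (Real.sqrt_nonneg _).trans_lt h1
      obtain ⟨h3, h4⟩ := (hN.slice ha hY h2 ((Real.sqrt_lt' hY).1 h1) X).1.1 h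
      exact ⟨⟨⟨h1, h2⟩, h3⟩, h4⟩
    · rintro ⟨⟨⟨h1, h2⟩, h3⟩, h4⟩
      have hY : 0 < Y := (Real.sqrt_nonneg _).trans_lt h1
      exact ⟨(hN.slice ha hY h2 ((Real.sqrt_lt' hY).1 h1) X).1.2 ⟨h3, h4⟩, h1, h2⟩

theorem frontier_inter_openStrip (ha : 0 < a) (hN : N.IsReduced a) :
    frontier (betweenLowerBoundaries N.G N.F (lowerHeight a (invHeight N.E)) (a / 2)) ∩
        openStrip (lowerHeight a (invHeight N.E)) (a / 2) =
      (lowerBoundaryMinus N.G ∪ lowerBoundaryPlus N.F) ∩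
        openStrip (lowerHeight a (invHeight N.E)) (a / 2) := by
  have hh : lowerHeight a (invHeight N.E) = √(N.apexSq a) := rfl
  rw [hh, hN.betweenLowerBoundaries_eq (Real.sqrt_nonneg _)]
  ext ⟨X, Y⟩
  refine and_congr_left ?_
  rintro ⟨h1, h2⟩
  have hY : 0 < Y := (Real.sqrt_nonneg _).trans_lt h1
  rw [frontier_between (continuous_leftOuter _) (continuous_rightOuter _) (hN.outer_lt ha) h1 h2,
    mem_union, mem_lowerBoundaryMinus_iff hN.isFactorization.orderTwo_G hY,
    mem_lowerBoundaryPlus_iff hN.isFactorization.orderTwo_F hY]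

end Triple.IsReduced

end Uplift

end

theorem proposition4 (a : ℝ) (ha : 0 < a) (T : Uplift.Triple) (hT : T.IsFactorization a)
    (hmax : max (Uplift.invHeight T.G) (Uplift.invHeight T.F) ≤ Uplift.invHeight T.E) :
    -- every step of the tree is a once-punctured trident
    (∀ N : Uplift.Triple, Uplift.InTree a T N →
      ∃ p q₁ q₂ : ℝ × ℝ,
        Uplift.IsApex N.G N.F p ∧
        Uplift.IsApex N.G N.E q₁ ∧ Uplift.Bifurcate N.G N.E q₁ ∧
        Uplift.IsApex N.F (Uplift.shift a N.E) q₂ ∧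
        Uplift.Bifurcate N.F (Uplift.shift a N.E) q₂ ∧
        Uplift.IsOncePuncturedTrident (Uplift.stepRegion a N)
          (Uplift.lowerHeight a (Uplift.invHeight N.E)) (a / 2) p q₁ q₂) ∧
    -- the whole tree fills an infinitely punctured domain
    Uplift.IsInfinitelyPuncturedDomain
      (Uplift.treeRegion a T ∩
        Uplift.openStrip (Uplift.lowerHeight a (Uplift.invHeight T.E)) (a / 2))
      (Uplift.betweenLowerBoundaries T.G T.F
        (Uplift.lowerHeight a (Uplift.invHeight T.E)) (a / 2))
      (Uplift.treePunctures a T) ∧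
    -- its boundary inside the strip consists of the two lower boundaries
    frontier (Uplift.betweenLowerBoundaries T.G T.F
        (Uplift.lowerHeight a (Uplift.invHeight T.E)) (a / 2)) ∩
        Uplift.openStrip (Uplift.lowerHeight a (Uplift.invHeight T.E)) (a / 2) =
      (Uplift.lowerBoundaryMinus T.G ∪ Uplift.lowerBoundaryPlus T.F) ∩
        Uplift.openStrip (Uplift.lowerHeight a (Uplift.invHeight T.E)) (a / 2) := by
  have hred : T.IsReduced a :=
    ⟨hT, (le_max_left _ _).trans hmax, (le_max_right _ _).trans hmax⟩
  refine ⟨fun N hN => ?_, hred.isInfinitelyPuncturedDomain ha, hred.frontier_inter_openStrip ha⟩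
  have hN' := hred.of_inTree ha hN
  have hp := (hN'.isApex_iff ha).2 rfl
  -- The bifurcations ap(GE) and ap(F S^a E S^{-a}) are by definition the apexes of λ(N) and, up to
  -- the order of the two elements, ρ(N).
  have hq₁ := ((hN'.lam ha).isApex_iff ha).2 rfl
  have hq₂ := (((hN'.rho ha).isApex_iff ha).2 rfl).symm
  exact ⟨_, _, _, hp, hq₁, hq₁.bifurcate, hq₂, hq₂.bifurcate, hN'.isOncePuncturedTrident ha⟩
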